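/- Let $A=(a_{ij})_{i,j\in I}$ be an affine Cartan matrix, that is, a finite indecomposable symmetrizable generalized Cartan matrix such that $Au=0$ for some vector $u$ with positive entries (twisted and untwisted types are allowed). Let $Q=\bigoplus_{i\in I}\mathbb Z\alpha_i$, $L=\bigoplus_{i\in I}\mathbb Z\Lambda_i$ and $P=L\oplus Q$. Let $h_i\in\operatorname{Hom}(P,\mathbb Z)$ be given by $\langle h_i,\alpha_j\rangle=a_{ij}$ and $\langle h_i,\Lambda_j\rangle=\delta_{ij}$, and let $W\subset\operatorname{Aut}(P)$ be the Weyl group, generated by the reflections $s_i(\lambda)=\lambda-\langle h_i,\lambda\rangle\alpha_i$ $(i\in I)$. Let $\delta\in\sum_i\mathbb Z_{\ge0}\alpha_i$ and $c\in\sum_i\mathbb Z_{\ge0}h_i$ be the elements with $$\{\alpha\in Q:\langle h_i,\alpha\rangle=0\ \text{for all } i\}=\mathbb Z\delta,\qquad \Bigl\{h\in\sum_{i}\mathbb Zh_i:\langle h,\alpha_i\rangle=0\ \text{for all } i\Bigr\}=\mathbb Zc.$$ Put $\rho=\sum_{i\in I}\Lambda_i$ and $\kappa^*=\langle c,\rho\rangle$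 (the dual Coxeter number). Let $\mathbb Z[P]=\bigoplus_{\lambda\in P}\mathbb Z e^\lambda$ be the group ring, on which $W$ acts by $w e^\lambda=e^{w\lambda}$. Let $R$ be the subring of $\mathbb Q(e^\delta)$ generated by $e^{\pm\delta}$ and $(e^{n\delta}-1)^{-1}$ for $n>0$, and let $W$ act trivially on $R$. Then: (i) if $|I|>2$, then $H^1\bigl(W,\,R\otimes_{\mathbb Z[e^{\pm\delta}]}\mathbb Z[P]\bigr)=0$; (ii) for every affine Cartan matrix (including $|I|=2$), $$H^1\Bigl(W,\;R\otimes_{\mathbb Z[e^{\pm\delta}]}\bigoplus_{\lambda\in P,\ |\langle c,\lambda\rangle|<\kappa^*}\mathbb Z e^\lambda\Bigr)=0 .$$ -/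

import Mathlib

open scoped LaurentPolynomial TensorProduct

/-- An affine Cartan matrix indexed by a finite set `I`: an indecomposable symmetrizable
generalized Cartan matrix `(a i j)` of affine type, i.e. killing a vector with positive entries.
All twisted and untwisted affine types are included. -/
structure AffineCartanMatrix (I : Type*) [Fintype I] where
  /-- The entries `a i j = ⟨h_i, α_j⟩`. -/
  a : Matrix I I ℤ
  diag : ∀ i, a i i = 2
  offDiag : ∀ i j, i ≠ j → a i j ≤ 0
  zero_iff : ∀ i j, a i j = 0 ↔ a j i = 0
  symmetrizable : ∃ d : I → ℤ, (∀ i, 0 < d i) ∧ ∀ i j, d i * a i j = d j * a j i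
  nonempty : Nonempty I
  indecomposable : ∀ J : Set I, J.Nonempty → J ≠ Set.univ → ∃ i ∈ J, ∃ j ∉ J, a i j ≠ 0
  affine : ∃ u : I → ℤ, (∀ i, 0 < u i) ∧ a.mulVec u = 0

namespace AffineCartanMatrix

/-- The integral kernel of an indecomposable matrix with nonpositive off-diagonal entries which
kills a positive vector is spanned by one nonnegative vector. -/
theorem exists_kernel_generator {I : Type*} [Fintype I] [Nonempty I] (a : Matrix I I ℤ)
    (hoff : ∀ i j, i ≠ j → a i j ≤ 0)
    (hind : ∀ J : Set I, J.Nonempty → J ≠ Set.univ → ∃ i ∈ J, ∃ j ∉ J, a i j ≠ 0)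
    (u : I → ℤ) (hu : ∀ i, 0 < u i) (hau : a.mulVec u = 0) :
    ∃ b : I → ℤ, (∀ i, 0 ≤ b i) ∧ ∀ v : I → ℤ, a.mulVec v = 0 ↔ ∃ n : ℤ, v = n • b := by
  classical
  have key : ∀ v : I → ℤ, a.mulVec v = 0 → ∀ i j, v i * u j = v j * u i := by
    intro v hv
    obtain ⟨k, hk⟩ := Finite.exists_max (fun i => (v i : ℚ) / u i)
    have hk' : ∀ j, v j * u k ≤ v k * u j := by
      intro j
      have h := hk j
      have h1 : (0 : ℚ) < u j := by exact_mod_cast hu j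
      have h2 : (0 : ℚ) < u k := by exact_mod_cast hu k
      rw [div_le_div_iff₀ h1 h2] at h
      exact_mod_cast h
    have hJ : {j | v j * u k = v k * u j} = Set.univ := by
      by_contra hne
      obtain ⟨i, hi, j, hj, hij⟩ := hind {j | v j * u k = v k * u j} ⟨k, rfl⟩ hne
      have hsum : ∑ l, a i l * (v k * u l - v l * u k) = 0 := by
        have h1 : ∑ l, a i l * u l = 0 := congrFun hau i
        have h2 : ∑ l, a i l * v l = 0 := congrFun hv i
        calc ∑ l, a i l * (v k * u l - v l * u k)
            = v k * ∑ l, a i l * u l - u k * ∑ l, a i l * v l := by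
              rw [Finset.mul_sum, Finset.mul_sum, ← Finset.sum_sub_distrib]
              exact Finset.sum_congr rfl fun l _ => by ring
          _ = 0 := by rw [h1, h2]; ring
      have hle : ∀ l ∈ Finset.univ, a i l * (v k * u l - v l * u k) ≤ 0 := by
        intro l _
        by_cases hl : i = l
        · subst hl
          have : v i * u k = v k * u i := hi
          rw [this]; simp
        · exact mul_nonpos_of_nonpos_of_nonneg (hoff i l hl) (by linarith [hk' l])
      have h0 := (Finset.sum_eq_zero_iff_of_nonpos hle).1 hsum j (Finset.mem_univ j)
      rcases mul_eq_zero.1 h0 with h | h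
      · exact hij h
      · exact hj (by change v j * u k = v k * u j; linarith)
    intro i j
    have hi : v i * u k = v k * u i := by
      have : i ∈ {j | v j * u k = v k * u j} := hJ ▸ Set.mem_univ i
      exact this
    have hj : v j * u k = v k * u j := by
      have : j ∈ {j | v j * u k = v k * u j} := hJ ▸ Set.mem_univ j
      exact this
    have := (hu k).ne'
    apply mul_right_cancel₀ this
    linear_combination (u j) * hi - (u i) * hj
  obtain ⟨b, hb, hgcd⟩ := Finset.extract_gcd u (Finset.univ_nonempty (α := I))
  set g := Finset.univ.gcd u with hg
  have hg0 : 0 ≤ g := by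
    apply Int.nonneg_of_normalize_eq_self
    rw [hg, Finset.normalize_gcd]
  have hub : ∀ i, u i = g * b i := fun i => hb i (Finset.mem_univ i)
  have hgpos : 0 < g := by
    rcases hg0.lt_or_eq with h | h
    · exact h
    · obtain ⟨i⟩ := ‹Nonempty I›
      have := hub i
      rw [← h, zero_mul] at this
      exact absurd this (hu i).ne'
  have hbpos : ∀ i, 0 < b i := fun i => by
    have := hu i
    rw [hub i] at this
    exact pos_of_mul_pos_right this hg0
  have hab : a.mulVec b = 0 := by
    have h : g • a.mulVec b = 0 := by
      rw [← Matrix.mulVec_smul, ← hau]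
      congr 1
      funext i
      simp [hub i]
    exact (smul_eq_zero.1 h).resolve_left hgpos.ne'
  refine ⟨b, fun i => (hbpos i).le, fun v => ⟨fun hv => ?_, ?_⟩⟩
  · have hvb : ∀ i j, v i * b j = v j * b i := by
      intro i j
      have h := key v hv i j
      rw [hub i, hub j] at h
      apply mul_left_cancel₀ hgpos.ne'
      linear_combination h
    obtain ⟨k⟩ := ‹Nonempty I›
    have hdvd : b k ∣ v k := by
      have h1 : b k ∣ Finset.univ.gcd fun j => v k * b j :=
        Finset.dvd_gcd fun j _ => ⟨v j, by rw [hvb k j, mul_comm]⟩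
      rw [Finset.gcd_mul_left, hgcd, mul_one] at h1
      exact h1.trans (normalize_associated (v k)).dvd
    obtain ⟨n, hn⟩ := hdvd
    refine ⟨n, funext fun j => ?_⟩
    apply mul_right_cancel₀ (hbpos k).ne'
    rw [hvb j k, hn, Pi.smul_apply, smul_eq_mul]
    ring
  · rintro ⟨n, rfl⟩
    rw [Matrix.mulVec_smul, hab, smul_zero]

section

variable {I : Type*} [Fintype I] (A : AffineCartanMatrix I)

theorem exists_marks : ∃ b : I → ℤ, (∀ i, 0 ≤ b i) ∧
    ∀ v : I → ℤ, A.a.mulVec v = 0 ↔ ∃ n : ℤ, v = n • b := by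
  have := A.nonempty
  obtain ⟨u, hu, hau⟩ := A.affine
  exact exists_kernel_generator A.a A.offDiag A.indecomposable u hu hau

theorem exists_comarks : ∃ b : I → ℤ, (∀ i, 0 ≤ b i) ∧
    ∀ v : I → ℤ, A.a.transpose.mulVec v = 0 ↔ ∃ n : ℤ, v = n • b := by
  have := A.nonempty
  obtain ⟨u, hu, hau⟩ := A.affine
  obtain ⟨d, hd, hda⟩ := A.symmetrizable
  refine exists_kernel_generator A.a.transpose (fun i j h => A.offDiag j i h.symm) ?_
    (fun i => d i * u i) (fun i => mul_pos (hd i) (hu i)) ?_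
  · intro J hJ hJ'
    obtain ⟨i, hi, j, hj, hij⟩ := A.indecomposable J hJ hJ'
    exact ⟨i, hi, j, hj, fun h => hij ((A.zero_iff i j).2 h)⟩
  · funext j
    have h : ∑ i, A.a j i * u i = 0 := congrFun hau j
    change ∑ i, A.a i j * (d i * u i) = 0
    calc ∑ i, A.a i j * (d i * u i) = d j * ∑ i, A.a j i * u i := by
          rw [Finset.mul_sum]
          exact Finset.sum_congr rfl fun i _ => by linear_combination u i * hda i j
      _ = 0 := by rw [h, mul_zero]

/-- The coefficients `a_i` of `δ = ∑ a_i α_i`, characterized by `marks_nonneg` and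
`mulVec_eq_zero_iff`. -/
noncomputable def marks : I → ℤ := A.exists_marks.choose

theorem marks_nonneg (i : I) : 0 ≤ A.marks i := A.exists_marks.choose_spec.1 i

theorem mulVec_eq_zero_iff (v : I → ℤ) : A.a.mulVec v = 0 ↔ ∃ n : ℤ, v = n • A.marks :=
  A.exists_marks.choose_spec.2 v

/-- The coefficients `a_i^∨` of `c = ∑ a_i^∨ h_i`, characterized by `comarks_nonneg` and
`transpose_mulVec_eq_zero_iff`. -/
noncomputable def comarks : I → ℤ := A.exists_comarks.choose

theorem comarks_nonneg (i : I) : 0 ≤ A.comarks i := A.exists_comarks.choose_spec.1 i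

theorem transpose_mulVec_eq_zero_iff (v : I → ℤ) :
    A.a.transpose.mulVec v = 0 ↔ ∃ n : ℤ, v = n • A.comarks :=
  A.exists_comarks.choose_spec.2 v

/-- The weight lattice `P = L ⊕ Q`, where `L = ⨁ ℤ Λ_i` and `Q = ⨁ ℤ α_i`: the pair `(l, q)`
stands for `∑ l i • Λ_i + ∑ q i • α_i`. -/
abbrev WeightLattice (_A : AffineCartanMatrix I) : Type _ := (I → ℤ) × (I → ℤ)

/-- The simple coroot `h_i`, with `⟨h_i, Λ_j⟩ = δ_ij` and `⟨h_i, α_j⟩ = a i j`. -/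
noncomputable def coroot (i : I) : Module.Dual ℤ A.WeightLattice :=
  LinearMap.coprod (LinearMap.proj i) (LinearMap.proj i ∘ₗ A.a.mulVecLin)

theorem coroot_apply (i : I) (x : A.WeightLattice) :
    A.coroot i x = x.1 i + A.a.mulVec x.2 i := rfl

/-- The imaginary root `δ = ∑ a_i α_i`. -/
noncomputable def delta : A.WeightLattice := (0, A.marks)

theorem coroot_delta (i : I) : A.coroot i A.delta = 0 := by
  have h : A.a.mulVec A.marks = 0 := (A.mulVec_eq_zero_iff _).2 ⟨1, by simp⟩
  simp [coroot_apply, delta, h]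

/-- The canonical central element `c = ∑ a_i^∨ h_i`. -/
noncomputable def c : Module.Dual ℤ A.WeightLattice := ∑ i, A.comarks i • A.coroot i

theorem c_delta : A.c A.delta = 0 := by
  simp only [c, LinearMap.sum_apply, LinearMap.smul_apply, coroot_delta, smul_zero,
    Finset.sum_const_zero]

/-- `ρ = ∑ Λ_i`. -/
def rho : A.WeightLattice := (fun _ => 1, 0)

/-- The group ring `ℤ[P]`; the element `e^x` is `AddMonoidAlgebra.single x 1`. -/
def GroupRing (A : AffineCartanMatrix I) : Type _ := AddMonoidAlgebra ℤ A.WeightLattice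

noncomputable instance : CommRing A.GroupRing :=
  inferInstanceAs (CommRing (AddMonoidAlgebra ℤ A.WeightLattice))

/-- The inclusion `ℤ[e^{±δ}] → ℤ[P]`, where `ℤ[e^{±δ}]` is the ring of Laurent polynomials in the
variable `T = e^δ`. -/
noncomputable def laurentToGroupRing : ℤ[T;T⁻¹] →+* A.GroupRing :=
  AddMonoidAlgebra.mapDomainRingHom ℤ (zmultiplesHom A.WeightLattice A.delta)

noncomputable instance : Algebra ℤ[T;T⁻¹] A.GroupRing := A.laurentToGroupRing.toAlgebra

theorem smul_groupRing_def (p : ℤ[T;T⁻¹]) (f : A.GroupRing) :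
    p • f = A.laurentToGroupRing p * f := rfl

variable [DecidableEq I]

/-- The simple root `α_i`. -/
def root (i : I) : A.WeightLattice := (0, Pi.single i 1)

theorem coroot_root (i j : I) : A.coroot i (A.root j) = A.a i j := by
  simp [coroot_apply, root]

theorem c_root (j : I) : A.c (A.root j) = 0 := by
  have h : A.a.transpose.mulVec A.comarks = 0 :=
    (A.transpose_mulVec_eq_zero_iff _).2 ⟨1, by simp⟩
  have h' : ∑ i, A.a i j * A.comarks i = 0 := congrFun h j
  simp only [c, LinearMap.sum_apply, LinearMap.smul_apply, coroot_root, smul_eq_mul]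
  rw [← h']
  exact Finset.sum_congr rfl fun i _ => mul_comm _ _

/-- The simple reflection `s_i x = x - ⟨h_i, x⟩ α_i`. -/
noncomputable def simpleReflection (i : I) : A.WeightLattice ≃ₗ[ℤ] A.WeightLattice :=
  Module.reflection (x := A.root i) (f := A.coroot i) (by rw [coroot_root, A.diag])

theorem simpleReflection_apply (i : I) (x : A.WeightLattice) :
    A.simpleReflection i x = x - A.coroot i x • A.root i :=
  Module.reflection_apply _ _

/-- The Weyl group `W`, acting faithfully on `P`. -/
def weylGroup : Subgroup (A.WeightLattice ≃ₗ[ℤ] A.WeightLattice) :=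
  Subgroup.closure (Set.range A.simpleReflection)

theorem weylGroup_delta (w : A.weylGroup) : w.1 A.delta = A.delta := by
  obtain ⟨w, hw⟩ := w
  induction hw using Subgroup.closure_induction with
  | mem x hx =>
    obtain ⟨i, rfl⟩ := hx
    simp [simpleReflection_apply, coroot_delta]
  | one => rfl
  | mul x y _ _ hx hy => exact (congrArg x hy).trans hx
  | inv x _ hx => exact (LinearEquiv.symm_apply_eq x).2 hx.symm

theorem c_weylGroup (w : A.weylGroup) (x : A.WeightLattice) : A.c (w.1 x) = A.c x := by
  obtain ⟨w, hw⟩ := w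
  induction hw using Subgroup.closure_induction generalizing x with
  | mem y hy =>
    obtain ⟨i, rfl⟩ := hy
    change A.c (A.simpleReflection i x) = A.c x
    rw [simpleReflection_apply, map_sub, map_smul, c_root, smul_zero, sub_zero]
  | one => rfl
  | mul y z _ _ hy hz => exact (hy (z x)).trans (hz x)
  | inv y _ hy =>
    have := hy (y⁻¹ x)
    rw [← this]
    exact congrArg A.c (LinearEquiv.apply_symm_apply y x)

/-- The ring homomorphism `e^x ↦ e^{w x}` of `ℤ[P]`. -/
noncomputable def weylRingHom (w : A.weylGroup) : A.GroupRing →+* A.GroupRing :=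
  AddMonoidAlgebra.mapDomainRingHom ℤ (w.1 : A.WeightLattice →+ A.WeightLattice)

theorem weylRingHom_laurent (w : A.weylGroup) (p : ℤ[T;T⁻¹]) :
    A.weylRingHom w (A.laurentToGroupRing p) = A.laurentToGroupRing p := by
  change AddMonoidAlgebra.mapDomain _ (AddMonoidAlgebra.mapDomain _ p) =
    AddMonoidAlgebra.mapDomain _ p
  refine congrArg AddMonoidAlgebra.ofCoeff (Finsupp.mapDomain_comp.symm.trans ?_)
  congr 1
  funext n
  change w.1 (n • A.delta) = n • A.delta
  rw [map_zsmul, weylGroup_delta]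

/-- The representation of `W` on `ℤ[P]`, with `w e^x = e^{w x}`; it is linear over `ℤ[e^{±δ}]`. -/
noncomputable def groupRingRep : Representation ℤ[T;T⁻¹] A.weylGroup A.GroupRing where
  toFun w :=
    { toFun := A.weylRingHom w
      map_add' := map_add _
      map_smul' := fun p f => by
        rw [smul_groupRing_def, map_mul, weylRingHom_laurent]
        rfl }
  map_one' := LinearMap.ext fun f => by
    change AddMonoidAlgebra.mapDomain id f = f
    exact congrArg AddMonoidAlgebra.ofCoeff Finsupp.mapDomain_id
  map_mul' v w := LinearMap.ext fun f => by
    change AddMonoidAlgebra.mapDomain (v.1 ∘ w.1) f =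
      AddMonoidAlgebra.mapDomain v.1 (AddMonoidAlgebra.mapDomain w.1 f)
    exact congrArg AddMonoidAlgebra.ofCoeff Finsupp.mapDomain_comp

/-- The dual Coxeter number `κ* = ⟨c, ρ⟩`. -/
noncomputable def dualCoxeterNumber : ℤ := A.c A.rho

/-- The `ℤ[e^{±δ}]`-submodule `⨁ ℤ e^x` of `ℤ[P]`, over the `x ∈ P` with `|⟨c, x⟩| < κ*`. -/
noncomputable def lowLevelSubmodule : Submodule ℤ[T;T⁻¹] A.GroupRing where
  toAddSubmonoid := (AddMonoidAlgebra.supported ℤ ℤ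
    {x : A.WeightLattice | |A.c x| < A.dualCoxeterNumber}).toAddSubmonoid
  smul_mem' p f hf := by
    classical
    intro x hx
    obtain ⟨y, hy, z, hz, rfl⟩ := Finset.mem_add.1 (AddMonoidAlgebra.support_coeff_mul_subset _ _ hx)
    obtain ⟨n, -, rfl⟩ := Finset.mem_image.1 (Finsupp.mapDomain_support hy)
    have hc : A.c (zmultiplesHom A.WeightLattice A.delta n + z) = A.c z := by
      rw [zmultiplesHom_apply, map_add, map_zsmul, c_delta, smul_zero, zero_add]
    have := hf hz
    change |A.c _| < _
    rw [hc]
    exact this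

/-- The `W`-submodule `⨁ ℤ e^x` of `ℤ[P]`, over the `x ∈ P` with `|⟨c, x⟩| < κ*`. -/
noncomputable def lowLevel : Subrepresentation A.groupRingRep where
  toSubmodule := A.lowLevelSubmodule
  apply_mem_toSubmodule w f hf := by
    classical
    intro x hx
    obtain ⟨y, hy, rfl⟩ := Finset.mem_image.1 (Finsupp.mapDomain_support hx)
    have hc : A.c ((w.1 : A.WeightLattice →+ A.WeightLattice) y) = A.c y := A.c_weylGroup w y
    have := hf hy
    change |A.c _| < _
    rw [hc]
    exact this

end

/-- The subring `R` of `ℚ(e^δ)` generated by `e^{±δ}` and `(e^{nδ} - 1)⁻¹` for `n > 0`, where `e^δ`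
is the variable of the field of rational functions. -/
noncomputable def R : Subring (RatFunc ℚ) :=
  Subring.closure ({RatFunc.X, RatFunc.X⁻¹} ∪ {f | ∃ n : ℕ, 0 < n ∧ f = (RatFunc.X ^ n - 1)⁻¹})

/-- `e^δ` as a unit of `R`. -/
noncomputable def expDelta : Rˣ where
  val := ⟨RatFunc.X, Subring.subset_closure (by simp)⟩
  inv := ⟨RatFunc.X⁻¹, Subring.subset_closure (by simp)⟩
  val_inv := Subtype.ext (mul_inv_cancel₀ RatFunc.X_ne_zero)
  inv_val := Subtype.ext (inv_mul_cancel₀ RatFunc.X_ne_zero)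

/-- The inclusion `ℤ[e^{±δ}] → R`. -/
noncomputable instance : Algebra ℤ[T;T⁻¹] R :=
  (LaurentPolynomial.eval₂ (Int.castRingHom R) expDelta).toAlgebra

/-- The `G`-module `R ⊗ M` over `ℤ[e^{±δ}]`, with `g (r ⊗ m) = r ⊗ g m`, as a representation on an
abelian group. -/
noncomputable def tensorR {G M : Type} [Group G] [AddCommGroup M] [Module ℤ[T;T⁻¹] M]
    (σ : Representation ℤ[T;T⁻¹] G M) : Rep ℤ G :=
  Rep.of (X := R ⊗[ℤ[T;T⁻¹]] M)
    { toFun g := (LinearMap.lTensor R (σ g)).restrictScalars ℤ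
      map_one' := by
        rw [map_one, Module.End.one_eq_id, LinearMap.lTensor_id]
        rfl
      map_mul' g h := by
        rw [map_mul, Module.End.mul_eq_comp, LinearMap.lTensor_comp]
        rfl }

end AffineCartanMatrix

namespace AffineCartanMatrix

/-! ### Positivity of the invariant form on the root lattice -/

section

variable {I : Type*} [Fintype I] (A : AffineCartanMatrix I)

/-! Write `q` for `e^δ`. Choosing coordinates turns `R ⊗ ℤ[P]` into the functions `u : P → R` with
`u (x + δ) = q⁻¹ u x` that are supported on finitely many cosets of `ℤδ`; `w` acts by `u ↦ u ∘ w⁻¹`.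
The level `c` is invariant under `W`, so a cocycle `F` splits into its level-zero part and the rest
(`exists_primitive`).

The main tool is a supply of translations: elements of `W` moving every level-zero weight by a
multiple of `δ`. They commute, are stable under conjugation, and a nontrivial one exists by
pigeonhole: `W` is infinite, while the images of the simple roots fall into finitely many classes
modulo `δ`.

At level zero a translation multiplies the coefficient at `x` by some `q ^ n`, and `q ^ n - 1` is
invertible in `R` for `n ≠ 0`. Unless `x` is fixed by `W`, one of finitely many translations has `n
≠ 0` there, and dividing by `q ^ n - 1` yields a primitive (`exists_primitive_level_zero`). At fixed
weights `F` is a homomorphism from a group generated by involutions to a ring without 2-torsion,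
hence zero.

At nonzero level translations push supports to infinity, so `t - 1` is injective for `t ≠ 1`. If
`|I| > 2` there are two independent translations `t`, `t'`. The relation `(t' - 1) F(t) = (t - 1)
F(t')`, together with a grading preserved by `t` and shifted by `t'`, puts `F(t)` in the image of `t
- 1` (`exists_antidifference`). Once `F(t)` is corrected to zero, injectivity kills the remaining
values.

If `|I| = 2`, the restrictions of `F` to the two reflections have primitives `v`, `v'`. They can be
merged when `v' - v` is a sum of two functions, each invariant under one reflection. For `0 < |c x|
< κ*` every orbit meets a wall (`wall_induction`), and such a decomposition propagates from the wall
along the orbit. -/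

theorem marks_pos (i : I) : 0 < A.marks i := by
  obtain ⟨u, hu, hau⟩ := A.affine
  obtain ⟨n, rfl⟩ := (A.mulVec_eq_zero_iff u).1 hau
  refine (A.marks_nonneg i).lt_of_ne fun h => ?_
  have := hu i
  simp [← h] at this

theorem mulVec_marks : A.a.mulVec A.marks = 0 := (A.mulVec_eq_zero_iff _).2 ⟨1, by simp⟩

/-- Positive integers `d i` with `d i * a i j = d j * a j i`. -/
noncomputable def symmetrizer : I → ℤ := A.symmetrizable.choose

theorem symmetrizer_pos (i : I) : 0 < A.symmetrizer i := A.symmetrizable.choose_spec.1 i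

theorem symmetrizer_mul (i j : I) : A.symmetrizer i * A.a i j = A.symmetrizer j * A.a j i :=
  A.symmetrizable.choose_spec.2 i j

/-- Symmetrizability carries the right kernel of `A.a` to its left kernel, which is spanned by the
comarks. The factor `n` is what relates pairing with `δ` to the level. -/
theorem exists_symmetrizer_mul_marks :
    ∃ n : ℤ, 0 < n ∧ (∀ i, A.symmetrizer i * A.marks i = n * A.comarks i) ∧
      ∀ i, 0 < A.comarks i := by
  have h : A.a.transpose.mulVec (fun i => A.symmetrizer i * A.marks i) = 0 := by
    funext j
    have h : ∑ i, A.a j i * A.marks i = 0 := congrFun A.mulVec_marks j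
    change ∑ i, A.a i j * (A.symmetrizer i * A.marks i) = 0
    calc ∑ i, A.a i j * (A.symmetrizer i * A.marks i)
        = A.symmetrizer j * ∑ i, A.a j i * A.marks i := by
          rw [Finset.mul_sum]
          exact Finset.sum_congr rfl fun i _ => by
            linear_combination A.marks i * A.symmetrizer_mul i j
      _ = 0 := by rw [h, mul_zero]
  obtain ⟨n, hn⟩ := (A.transpose_mulVec_eq_zero_iff _).1 h
  have hn' : ∀ i, A.symmetrizer i * A.marks i = n * A.comarks i := fun i => congrFun hn i
  have hpos : ∀ i, 0 < n * A.comarks i := fun i => by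
    rw [← hn' i]
    exact mul_pos (A.symmetrizer_pos i) (A.marks_pos i)
  obtain ⟨k⟩ := A.nonempty
  have hn0 : 0 < n := pos_of_mul_pos_left (hpos k) (A.comarks_nonneg k)
  exact ⟨n, hn0, hn', fun i => pos_of_mul_pos_right (hpos i) hn0.le⟩

theorem comarks_pos (i : I) : 0 < A.comarks i :=
  A.exists_symmetrizer_mul_marks.choose_spec.2.2 i

/-- The factor between the form with `δ` and the level. -/
noncomputable def formScale : ℤ := A.exists_symmetrizer_mul_marks.choose

theorem formScale_pos : 0 < A.formScale := A.exists_symmetrizer_mul_marks.choose_spec.1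

theorem symmetrizer_mul_marks (i : I) :
    A.symmetrizer i * A.marks i = A.formScale * A.comarks i :=
  A.exists_symmetrizer_mul_marks.choose_spec.2.1 i

theorem zsmul_delta_injective {m n : ℤ} (h : m • A.delta = n • A.delta) : m = n := by
  obtain ⟨k⟩ := A.nonempty
  have h1 : m * A.marks k = n * A.marks k := congrFun (congrArg Prod.snd h) k
  exact mul_right_cancel₀ (A.marks_pos k).ne' h1

theorem c_apply (x : A.WeightLattice) : A.c x = ∑ i, A.comarks i * A.coroot i x := by
  simp [c]

theorem c_rho : A.c A.rho = ∑ i, A.comarks i := by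
  simp [c_apply, coroot_apply, rho]

theorem c_of_fst_eq_zero {x : A.WeightLattice} (hx : x.1 = 0) : A.c x = 0 := by
  have h : A.a.transpose.mulVec A.comarks = 0 :=
    (A.transpose_mulVec_eq_zero_iff _).2 ⟨1, by simp⟩
  simp only [c_apply, coroot_apply, hx, Pi.zero_apply, zero_add]
  change A.comarks ⬝ᵥ A.a.mulVec x.2 = 0
  rw [Matrix.dotProduct_mulVec, ← Matrix.mulVec_transpose, h, zero_dotProduct]

/-- The invariant symmetric form on the weight lattice, with `(α_i, x) = d_i ⟨h_i, x⟩` and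
`(Λ_i, Λ_j) = 0`. -/
noncomputable def form : A.WeightLattice →ₗ[ℤ] A.WeightLattice →ₗ[ℤ] ℤ :=
  LinearMap.mk₂ ℤ
    (fun x y => ∑ i, A.symmetrizer i * (x.1 i * y.2 i + x.2 i * A.coroot i y))
    (fun x x' y => by
      rw [← Finset.sum_add_distrib]
      exact Finset.sum_congr rfl fun i _ => by simp only [Prod.fst_add, Prod.snd_add, Pi.add_apply]; ring)
    (fun c x y => by
      rw [smul_eq_mul, Finset.mul_sum]
      exact Finset.sum_congr rfl fun i _ => by
        simp only [Prod.smul_fst, Prod.smul_snd, Pi.smul_apply, smul_eq_mul]; ring)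
    (fun x y y' => by
      rw [← Finset.sum_add_distrib]
      exact Finset.sum_congr rfl fun i _ => by
        simp only [Prod.snd_add, Pi.add_apply, map_add]; ring)
    (fun c x y => by
      rw [smul_eq_mul, Finset.mul_sum]
      exact Finset.sum_congr rfl fun i _ => by
        simp only [Prod.smul_snd, Pi.smul_apply, map_smul, smul_eq_mul]; ring)

theorem form_apply (x y : A.WeightLattice) :
    A.form x y = ∑ i, A.symmetrizer i * (x.1 i * y.2 i + x.2 i * A.coroot i y) := rfl

theorem form_comm (x y : A.WeightLattice) : A.form x y = A.form y x := by
  have key : ∀ x y : A.WeightLattice, A.form x y =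
      ∑ i, A.symmetrizer i * (x.1 i * y.2 i + x.2 i * y.1 i) +
        ∑ i, ∑ j, A.symmetrizer i * A.a i j * x.2 i * y.2 j := by
    intro x y
    rw [form_apply, ← Finset.sum_add_distrib]
    refine Finset.sum_congr rfl fun i _ => ?_
    have h : A.a.mulVec y.2 i = ∑ j, A.a i j * y.2 j := rfl
    have h' : ∑ j, A.symmetrizer i * A.a i j * x.2 i * y.2 j =
        A.symmetrizer i * x.2 i * ∑ j, A.a i j * y.2 j := by
      rw [Finset.mul_sum]
      exact Finset.sum_congr rfl fun j _ => by ring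
    rw [coroot_apply, h', h]
    ring
  rw [key x y, key y x, Finset.sum_comm]
  congr 1
  · exact Finset.sum_congr rfl fun i _ => by ring
  · exact Finset.sum_congr rfl fun i _ => Finset.sum_congr rfl fun j _ => by
      linear_combination x.2 j * y.2 i * A.symmetrizer_mul j i

theorem form_delta (y : A.WeightLattice) : A.form A.delta y = A.formScale * A.c y := by
  rw [form_apply, c_apply, Finset.mul_sum]
  refine Finset.sum_congr rfl fun i _ => ?_
  simp only [delta, Pi.zero_apply]
  linear_combination A.coroot i y * A.symmetrizer_mul_marks i

theorem exists_eq_zsmul_delta {x : A.WeightLattice} (hx : x.1 = 0)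
    (h : ∀ i, A.coroot i x = 0) : ∃ n : ℤ, x = n • A.delta := by
  have h' : A.a.mulVec x.2 = 0 := by
    funext i
    simpa [coroot_apply, hx] using h i
  obtain ⟨n, hn⟩ := (A.mulVec_eq_zero_iff _).1 h'
  exact ⟨n, Prod.ext (by simp [hx, delta]) hn⟩

/-- Sum-of-squares formula for the form on the root lattice. -/
theorem form_self_of_fst_eq_zero {x : A.WeightLattice} (hx : x.1 = 0) :
    ∑ i, ∑ j, (-(A.symmetrizer i * A.a i j * A.marks i * A.marks j) : ℚ) *
      (x.2 i / A.marks i - x.2 j / A.marks j) ^ 2 = 2 * A.form x x := by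
  have hm : ∀ i, (A.marks i : ℚ) ≠ 0 := fun i => by exact_mod_cast (A.marks_pos i).ne'
  have h1 : ∀ i, ∑ j, (A.a i j * A.marks j : ℚ) = 0 := fun i => by
    have h : ∑ j, A.a i j * A.marks j = 0 := congrFun A.mulVec_marks i
    exact_mod_cast h
  -- The pure square terms cancel because the matrix kills the marks; only the cross terms survive.
  have h2 : ∑ i, ∑ j, (A.symmetrizer i * A.a i j * A.marks i * A.marks j : ℚ) *
      (x.2 i / A.marks i) ^ 2 = 0 := by
    refine Finset.sum_eq_zero fun i _ => ?_
    have : ∑ j, (A.symmetrizer i * A.a i j * A.marks i * A.marks j : ℚ) *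
        (x.2 i / A.marks i) ^ 2 =
        A.symmetrizer i * A.marks i * (x.2 i / A.marks i) ^ 2 * ∑ j, (A.a i j * A.marks j : ℚ) := by
      rw [Finset.mul_sum]
      exact Finset.sum_congr rfl fun j _ => by ring
    rw [this, h1, mul_zero]
  have h3 : ∑ i, ∑ j, (A.symmetrizer i * A.a i j * A.marks i * A.marks j : ℚ) *
      (x.2 j / A.marks j) ^ 2 = 0 := by
    rw [Finset.sum_comm, ← h2]
    refine Finset.sum_congr rfl fun i _ => Finset.sum_congr rfl fun j _ => ?_
    have : (A.symmetrizer j * A.a j i : ℚ) = A.symmetrizer i * A.a i j := by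
      exact_mod_cast A.symmetrizer_mul j i
    rw [this]
    ring
  have h4 : (A.form x x : ℚ) = ∑ i, ∑ j, (A.symmetrizer i * A.a i j * x.2 i * x.2 j : ℚ) := by
    rw [form_apply]
    push_cast
    refine Finset.sum_congr rfl fun i _ => ?_
    have h : A.coroot i x = ∑ j, A.a i j * x.2 j := by
      rw [coroot_apply, hx]
      exact zero_add _
    rw [h, hx, Int.cast_sum, Finset.mul_sum, mul_add, Finset.mul_sum]
    simp only [Pi.zero_apply, Int.cast_zero, zero_mul, mul_zero, zero_add]
    exact Finset.sum_congr rfl fun j _ => by push_cast; ring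
  calc ∑ i, ∑ j, (-(A.symmetrizer i * A.a i j * A.marks i * A.marks j) : ℚ) *
      (x.2 i / A.marks i - x.2 j / A.marks j) ^ 2
      = 2 * (∑ i, ∑ j, (A.symmetrizer i * A.a i j * x.2 i * x.2 j : ℚ)) -
        (∑ i, ∑ j, (A.symmetrizer i * A.a i j * A.marks i * A.marks j : ℚ) *
          (x.2 i / A.marks i) ^ 2) -
        (∑ i, ∑ j, (A.symmetrizer i * A.a i j * A.marks i * A.marks j : ℚ) *
          (x.2 j / A.marks j) ^ 2) := by
        rw [Finset.mul_sum, ← Finset.sum_sub_distrib, ← Finset.sum_sub_distrib]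
        refine Finset.sum_congr rfl fun i _ => ?_
        rw [Finset.mul_sum, ← Finset.sum_sub_distrib, ← Finset.sum_sub_distrib]
        refine Finset.sum_congr rfl fun j _ => ?_
        have := hm i
        have := hm j
        field_simp
        ring
    _ = 2 * A.form x x := by rw [h2, h3, h4]; ring

/-- A nonempty set of indices closed under adjacency in the Dynkin diagram is everything. -/
theorem forall_of_adjacent {p : I → Prop} (k : I) (hk : p k)
    (h : ∀ i j, p i → i ≠ j → A.a i j ≠ 0 → p j) (i : I) : p i := by
  have : {i | p i} = Set.univ := by
    by_contra hne
    obtain ⟨i, hi, j, hj, hij⟩ := A.indecomposable {i | p i} ⟨k, hk⟩ hne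
    exact hj (h i j hi (fun e => hj (e ▸ hi)) hij)
  exact Set.eq_univ_iff_forall.1 this i

/-- In the sum-of-squares formula an adjacent pair has an integer coefficient at least `1`, so a
norm bound controls the difference of its two ratios. Connectedness of the Dynkin diagram spreads
this to all pairs. -/
theorem exists_bound_of_form_le (C : ℤ) (k : I) (i : I) : ∃ K : ℚ, ∀ x : A.WeightLattice,
    x.1 = 0 → A.form x x ≤ C → |(x.2 i / A.marks i - x.2 k / A.marks k : ℚ)| ≤ K := by
  refine A.forall_of_adjacent (p := fun i => ∃ K : ℚ, ∀ x : A.WeightLattice,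
    x.1 = 0 → A.form x x ≤ C → |(x.2 i / A.marks i - x.2 k / A.marks k : ℚ)| ≤ K) k
    ⟨0, by simp⟩ ?_ i
  rintro i j ⟨K, hK⟩ hij ha
  -- The increment `r` satisfies `r ^ 2 ≤ 2 * C`; the cruder bound `|r| ≤ 2 * C + 1` avoids square
  -- roots.
  refine ⟨K + (2 * C + 1), fun x hx hC => ?_⟩
  have hnn : ∀ i j, 0 ≤ (-(A.symmetrizer i * A.a i j * A.marks i * A.marks j) : ℚ) *
      (x.2 i / A.marks i - x.2 j / A.marks j) ^ 2 := by
    intro i j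
    by_cases h : i = j
    · subst h; simp
    · refine mul_nonneg ?_ (sq_nonneg _)
      have h1 := A.offDiag i j h
      have h2 : A.symmetrizer i * A.a i j * A.marks i * A.marks j ≤ 0 :=
        mul_nonpos_of_nonpos_of_nonneg (mul_nonpos_of_nonpos_of_nonneg
          (mul_nonpos_of_nonneg_of_nonpos (A.symmetrizer_pos i).le h1) (A.marks_nonneg i))
          (A.marks_nonneg j)
      have h3 : (A.symmetrizer i * A.a i j * A.marks i * A.marks j : ℚ) ≤ 0 := by exact_mod_cast h2
      linarith
  have hone : (1 : ℚ) ≤ -(A.symmetrizer i * A.a i j * A.marks i * A.marks j) := by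
    have h1 : 0 < -A.a i j := by
      have := lt_of_le_of_ne (A.offDiag i j hij) ha
      linarith
    have h2 : 0 < A.symmetrizer i * (-A.a i j) * A.marks i * A.marks j :=
      mul_pos (mul_pos (mul_pos (A.symmetrizer_pos i) h1) (A.marks_pos i)) (A.marks_pos j)
    have h3 : 1 ≤ -(A.symmetrizer i * A.a i j * A.marks i * A.marks j) := by
      linarith
    exact_mod_cast h3
  have hsq : (x.2 i / A.marks i - x.2 j / A.marks j : ℚ) ^ 2 ≤ 2 * C := by
    have h1 := Finset.single_le_sum (f := fun j =>
      (-(A.symmetrizer i * A.a i j * A.marks i * A.marks j) : ℚ) *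
      (x.2 i / A.marks i - x.2 j / A.marks j) ^ 2) (fun j _ => hnn i j) (Finset.mem_univ j)
    have h2 := Finset.single_le_sum (f := fun i => ∑ j,
      (-(A.symmetrizer i * A.a i j * A.marks i * A.marks j) : ℚ) *
      (x.2 i / A.marks i - x.2 j / A.marks j) ^ 2)
      (fun i _ => Finset.sum_nonneg fun j _ => hnn i j) (Finset.mem_univ i)
    rw [A.form_self_of_fst_eq_zero hx] at h2
    have h3 : (A.form x x : ℚ) ≤ C := by exact_mod_cast hC
    have h4 := mul_le_mul_of_nonneg_right hone
      (sq_nonneg (x.2 i / A.marks i - x.2 j / A.marks j : ℚ))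
    exact h4.trans' (one_mul _).ge |>.trans (h1.trans (h2.trans (by linarith)))
  have hK' := abs_le.1 (hK x hx hC)
  set r : ℚ := x.2 i / A.marks i - x.2 j / A.marks j
  have h1 : r ≤ 2 * C + 1 := by nlinarith [sq_nonneg (r - 1)]
  have h2 : -(2 * C + 1) ≤ r := by nlinarith [sq_nonneg (r + 1)]
  have h3 : (x.2 j / A.marks j - x.2 k / A.marks k : ℚ) =
    (x.2 i / A.marks i - x.2 k / A.marks k) - r := by ring
  rw [h3, abs_le]
  constructor <;> linarith [hK'.1, hK'.2]

/-- Modulo `δ` there are finitely many elements of the root lattice of bounded norm. -/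
theorem exists_finite_reps (C : ℤ) : ∃ F : Set (A.WeightLattice), F.Finite ∧
    ∀ x : A.WeightLattice, x.1 = 0 → A.form x x ≤ C → ∃ y ∈ F, ∃ n : ℤ, x = y + n • A.delta := by
  classical
  obtain ⟨k⟩ := A.nonempty
  choose K hK using A.exists_bound_of_form_le C k
  let b : I → ℤ := fun i => ⌈(A.marks i : ℚ) * (K i + 1)⌉
  refine ⟨{0} ×ˢ Set.Icc (-b) b, (Set.finite_singleton _).prod (Set.finite_Icc _ _), ?_⟩
  intro x hx hC
  -- Removing this multiple of `δ` brings the `k`-th ratio into `[0, 1)`; this accounts for the `+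
  -- 1` in `b`.
  let n := x.2 k / A.marks k
  refine ⟨x - n • A.delta, ?_, n, by simp⟩
  have h0 : (x - n • A.delta).1 = 0 := by simp [hx, delta]
  have hd : A.form A.delta A.delta = 0 := by rw [form_delta, c_delta, mul_zero]
  have hxd : A.form A.delta x = 0 := by rw [form_delta, A.c_of_fst_eq_zero hx, mul_zero]
  have hB : A.form (x - n • A.delta) (x - n • A.delta) ≤ C := by
    simpa only [map_sub, map_zsmul, LinearMap.sub_apply, LinearMap.smul_apply, hd, hxd,
      A.form_comm x A.delta, smul_zero, sub_zero] using hC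
  have hk : (x - n • A.delta).2 k = x.2 k % A.marks k := by
    have := Int.emod_def (x.2 k) (A.marks k)
    simp only [Prod.snd_sub, Prod.smul_snd, Pi.sub_apply, Pi.smul_apply, delta, smul_eq_mul, n]
    linarith
  have hmod0 := Int.emod_nonneg (x.2 k) (A.marks_pos k).ne'
  have hmod1 := Int.emod_lt_of_pos (x.2 k) (A.marks_pos k)
  have habs : ∀ i, |((x - n • A.delta).2 i : ℚ)| ≤ A.marks i * (K i + 1) := by
    intro i
    have h := hK i _ h0 hB
    rw [hk] at h
    have hm : (0 : ℚ) < A.marks k := by exact_mod_cast A.marks_pos k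
    have hmi : (0 : ℚ) < A.marks i := by exact_mod_cast A.marks_pos i
    have h1 : (0 : ℚ) ≤ ((x.2 k % A.marks k : ℤ) : ℚ) / A.marks k :=
      div_nonneg (by exact_mod_cast hmod0) hm.le
    have h2 : ((x.2 k % A.marks k : ℤ) : ℚ) / A.marks k ≤ 1 := by
      rw [div_le_one hm]
      exact_mod_cast hmod1.le
    have h3 : |((x - n • A.delta).2 i / A.marks i : ℚ)| ≤ K i + 1 := by
      rw [abs_le] at h ⊢
      constructor <;> linarith [h.1, h.2]
    rw [abs_div, abs_of_pos hmi, div_le_iff₀ hmi] at h3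
    linarith
  refine ⟨h0, fun i => ?_, fun i => ?_⟩
  · have h := (abs_le.1 (habs i)).1
    have h' : -(b i : ℚ) ≤ (x - n • A.delta).2 i := by linarith [Int.le_ceil ((A.marks i : ℚ) * (K i + 1))]
    exact_mod_cast h'
  · have h := (abs_le.1 (habs i)).2
    have h' : ((x - n • A.delta).2 i : ℚ) ≤ b i := h.trans (Int.le_ceil _)
    exact_mod_cast h'

end

/-! ### The Weyl group and its action on the form -/

section

variable {I : Type*} [Fintype I] [DecidableEq I] (A : AffineCartanMatrix I)

theorem form_root (i : I) (y : A.WeightLattice) :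
    A.form (A.root i) y = A.symmetrizer i * A.coroot i y := by
  rw [form_apply, Finset.sum_eq_single i]
  · simp [root]
  · intro j _ hj
    simp [root, hj]
  · simp

theorem root_ne_zero (i : I) : A.root i ≠ 0 := fun h => by
  have := congrFun (congrArg Prod.snd h) i
  simp [root] at this

/-- The generator `s_i` of the Weyl group. -/
noncomputable def reflection (i : I) : A.weylGroup :=
  ⟨A.simpleReflection i, Subgroup.subset_closure ⟨i, rfl⟩⟩

theorem reflection_apply (i : I) (x : A.WeightLattice) :
    (A.reflection i).1 x = x - A.coroot i x • A.root i := A.simpleReflection_apply i x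

theorem reflection_mul_self (i : I) : A.reflection i * A.reflection i = 1 := by
  refine Subtype.ext (LinearEquiv.ext fun x => ?_)
  change (A.reflection i).1 ((A.reflection i).1 x) = x
  rw [reflection_apply, reflection_apply, map_sub, map_zsmul, coroot_root, A.diag]
  module

theorem reflection_inv (i : I) : (A.reflection i)⁻¹ = A.reflection i :=
  inv_eq_of_mul_eq_one_right (A.reflection_mul_self i)

variable {A} in
theorem weylGroup_induction {p : A.weylGroup → Prop} (w : A.weylGroup)
    (refl : ∀ i, p (A.reflection i)) (one : p 1) (mul : ∀ v w, p v → p w → p (v * w))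
    (inv : ∀ w, p w → p w⁻¹) : p w := by
  obtain ⟨w, hw⟩ := w
  induction hw using Subgroup.closure_induction with
  | mem x hx => obtain ⟨i, rfl⟩ := hx; exact refl i
  | one => exact one
  | mul x y hx hy h1 h2 => exact mul ⟨x, hx⟩ ⟨y, hy⟩ h1 h2
  | inv x hx h => exact inv ⟨x, hx⟩ h

variable {A}

theorem weylGroup_mul_apply (v w : A.weylGroup) (x : A.WeightLattice) :
    (v * w).1 x = v.1 (w.1 x) := rfl

@[simp]
theorem weylGroup_one_apply (x : A.WeightLattice) : (1 : A.weylGroup).1 x = x := rfl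

@[simp]
theorem weylGroup_inv_apply_self (w : A.weylGroup) (x : A.WeightLattice) :
    w⁻¹.1 (w.1 x) = x := by
  rw [← weylGroup_mul_apply, inv_mul_cancel, weylGroup_one_apply]

@[simp]
theorem weylGroup_apply_inv_self (w : A.weylGroup) (x : A.WeightLattice) :
    w.1 (w⁻¹.1 x) = x := by
  rw [← weylGroup_mul_apply, mul_inv_cancel, weylGroup_one_apply]

theorem form_weylGroup (w : A.weylGroup) (x y : A.WeightLattice) :
    A.form (w.1 x) (w.1 y) = A.form x y := by
  induction w using weylGroup_induction generalizing x y with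
  | refl i =>
    simp only [reflection_apply, map_sub, map_zsmul, LinearMap.sub_apply, LinearMap.smul_apply,
      form_root, coroot_root, A.diag, smul_eq_mul, A.form_comm x (A.root i)]
    ring
  | one => rfl
  | mul v w hv hw => exact (hv _ _).trans (hw _ _)
  | inv w hw => rw [← hw, weylGroup_apply_inv_self, weylGroup_apply_inv_self]

theorem fst_weylGroup (w : A.weylGroup) (x : A.WeightLattice) : (w.1 x).1 = x.1 := by
  induction w using weylGroup_induction generalizing x with
  | refl i => simp [reflection_apply, root]
  | one => rfl
  | mul v w hv hw => exact (hv _).trans (hw _)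
  | inv w hw => rw [← hw, weylGroup_apply_inv_self]

theorem fst_weylGroup_sub (w : A.weylGroup) (x : A.WeightLattice) : (w.1 x - x).1 = 0 := by
  rw [Prod.fst_sub, fst_weylGroup, sub_self]

theorem weylGroup_zsmul_delta (w : A.weylGroup) (n : ℤ) : w.1 (n • A.delta) = n • A.delta := by
  rw [map_zsmul, weylGroup_delta]

theorem weylGroup_apply_eq_self (w : A.weylGroup) {x : A.WeightLattice}
    (hx : ∀ i, A.coroot i x = 0) : w.1 x = x := by
  induction w using weylGroup_induction with
  | refl i => rw [reflection_apply, hx, zero_smul, sub_zero]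
  | one => rfl
  | mul v w hv hw => rw [weylGroup_mul_apply, hw, hv]
  | inv w hw => rw [← hw, weylGroup_inv_apply_self, hw]

variable (A) in
-- Averaging `ρ` over a finite group would give an invariant weight. Invariance forces all its
-- coroot pairings, hence its level, to vanish, but its level is a positive multiple of that of `ρ`.
theorem infinite_weylGroup : Infinite A.weylGroup := by
  by_contra hfin
  rw [not_infinite_iff_finite] at hfin
  have := Fintype.ofFinite A.weylGroup
  let x : A.WeightLattice := ∑ w : A.weylGroup, w.1 A.rho
  have hx : ∀ v : A.weylGroup, v.1 x = x := by
    intro v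
    rw [map_sum]
    exact Equiv.sum_comp (Equiv.mulLeft v) (fun w : A.weylGroup => w.1 A.rho)
  have h0 : ∀ i, A.coroot i x = 0 := by
    intro i
    have h := hx (A.reflection i)
    rw [reflection_apply, sub_eq_self] at h
    exact (smul_eq_zero.1 h).resolve_right (A.root_ne_zero i)
  have hc : A.c x = Fintype.card A.weylGroup * A.c A.rho := by
    rw [map_sum]
    simp [c_weylGroup]
  rw [c_apply] at hc
  simp only [h0, mul_zero, Finset.sum_const_zero] at hc
  have hρ : 0 < A.c A.rho := by
    rw [c_rho]
    have := A.nonempty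
    exact Finset.sum_pos (fun i _ => A.comarks_pos i) Finset.univ_nonempty
  have : (0 : ℤ) < Fintype.card A.weylGroup := by exact_mod_cast Fintype.card_pos
  exact (mul_pos this hρ).ne hc

/-! ### Translations -/

/-- Elements of the Weyl group which act trivially on the level zero weights modulo `δ`. -/
def IsTranslation (t : A.weylGroup) : Prop :=
  ∀ x : A.WeightLattice, A.c x = 0 → ∃ n : ℤ, t.1 x = x + n • A.delta

/-- The integer `n` with `t x = x + n δ`, if it exists. -/
noncomputable def shift (t : A.weylGroup) (x : A.WeightLattice) : ℤ :=
  open Classical in if h : ∃ n : ℤ, t.1 x = x + n • A.delta then h.choose else 0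

theorem shift_eq {t : A.weylGroup} {x : A.WeightLattice} {n : ℤ}
    (h : t.1 x = x + n • A.delta) : shift t x = n := by
  have h' : ∃ n : ℤ, t.1 x = x + n • A.delta := ⟨n, h⟩
  rw [shift, dif_pos h']
  exact A.zsmul_delta_injective (add_left_cancel (h'.choose_spec.symm.trans h))

namespace IsTranslation

variable {t t' : A.weylGroup}

theorem apply_eq (ht : IsTranslation t) {x : A.WeightLattice} (hx : A.c x = 0) :
    t.1 x = x + shift t x • A.delta := by
  obtain ⟨n, hn⟩ := ht x hx
  rw [shift_eq hn, hn]

theorem inv_apply_eq (ht : IsTranslation t) {x : A.WeightLattice} (hx : A.c x = 0) :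
    t⁻¹.1 x = x - shift t x • A.delta := by
  have h : t.1 (x - shift t x • A.delta) = x := by
    rw [map_sub, weylGroup_zsmul_delta, ht.apply_eq hx, add_sub_cancel_right]
  conv_lhs => rw [← h]
  rw [weylGroup_inv_apply_self]

theorem shift_add (ht : IsTranslation t) {x y : A.WeightLattice} (hx : A.c x = 0)
    (hy : A.c y = 0) : shift t (x + y) = shift t x + shift t y :=
  shift_eq (by rw [map_add, ht.apply_eq hx, ht.apply_eq hy]; module)

theorem shift_zsmul (ht : IsTranslation t) {x : A.WeightLattice} (hx : A.c x = 0) (n : ℤ) :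
    shift t (n • x) = n * shift t x :=
  shift_eq (by rw [map_zsmul, ht.apply_eq hx]; module)

theorem shift_sub_zsmul (ht : IsTranslation t) {x y : A.WeightLattice} (hx : A.c x = 0)
    (hy : A.c y = 0) (n : ℤ) : shift t (x - n • y) = shift t x - n * shift t y := by
  have hy' : A.c ((-n) • y) = 0 := by rw [map_zsmul, hy, smul_zero]
  rw [sub_eq_add_neg, ← neg_smul, ht.shift_add hx hy', ht.shift_zsmul hy]
  ring

/-- Compare `(t x, t y) = (x, y)` with `t y = y + shift t y • δ`. This drift, proportional to the
level, is what moves weights of nonzero level to infinity. -/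
theorem form_apply (ht : IsTranslation t) (x : A.WeightLattice) {y : A.WeightLattice}
    (hy : A.c y = 0) :
    A.form (t.1 x) y = A.form x y - A.formScale * shift t y * A.c x := by
  have h1 : A.form A.delta (t.1 x - x) = 0 := by
    rw [form_delta, A.c_of_fst_eq_zero (fst_weylGroup_sub t x), mul_zero]
  have h2 := form_weylGroup t x y
  have h3 := A.form_delta x
  rw [ht.apply_eq hy, map_add, map_zsmul] at h2
  rw [map_sub, form_comm, A.form_comm _ x] at h1
  rw [A.form_comm] at h3
  rw [sub_eq_zero.1 h1, h3] at h2
  simp only [smul_eq_mul] at h2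
  linarith

theorem conj (ht : IsTranslation t) (w : A.weylGroup) : IsTranslation (w * t * w⁻¹) := by
  intro x hx
  refine ⟨shift t (w⁻¹.1 x), ?_⟩
  rw [weylGroup_mul_apply, weylGroup_mul_apply, ht.apply_eq ((A.c_weylGroup _ _).trans hx), map_add,
    weylGroup_apply_inv_self, weylGroup_zsmul_delta]

theorem shift_conj (ht : IsTranslation t) (w : A.weylGroup) {x : A.WeightLattice}
    (hx : A.c x = 0) : shift (w * t * w⁻¹) x = shift t (w⁻¹.1 x) :=
  shift_eq (by
    rw [weylGroup_mul_apply, weylGroup_mul_apply, ht.apply_eq ((A.c_weylGroup _ _).trans hx),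
      map_add, weylGroup_apply_inv_self, weylGroup_zsmul_delta])

theorem shift_conj_reflection (ht : IsTranslation t) (i : I) {x : A.WeightLattice}
    (hx : A.c x = 0) : shift (A.reflection i * t * (A.reflection i)⁻¹) x =
      shift t x - A.coroot i x * shift t (A.root i) := by
  rw [ht.shift_conj _ hx, reflection_inv, reflection_apply,
    ht.shift_sub_zsmul hx (A.c_root i)]

/-- With `y = t x - x` and `y' = t' x - x`, the claim is `shift t y' = shift t' y`. At nonzero level
both are read off from the symmetric quantity `(y, y')`; at level zero `y` and `y'` are multiples of
`δ`. -/
theorem commute (ht : IsTranslation t) (ht' : IsTranslation t') : t * t' = t' * t := by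
  refine Subtype.ext (LinearEquiv.ext fun x => ?_)
  change t.1 (t'.1 x) = t'.1 (t.1 x)
  set y := t.1 x - x with hy
  set y' := t'.1 x - x with hy'
  have hcy : A.c y = 0 := A.c_of_fst_eq_zero (fst_weylGroup_sub t x)
  have hcy' : A.c y' = 0 := A.c_of_fst_eq_zero (fst_weylGroup_sub t' x)
  have h1 : t.1 x = x + y := by rw [hy]; abel
  have h2 : t'.1 x = x + y' := by rw [hy']; abel
  have key : shift t y' = shift t' y := by
    by_cases hx : A.c x = 0
    · have e1 : y = shift t x • A.delta := by rw [hy, ht.apply_eq hx]; abel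
      have e2 : y' = shift t' x • A.delta := by rw [hy', ht'.apply_eq hx]; abel
      rw [e1, e2, shift_eq (n := 0) (by rw [weylGroup_zsmul_delta]; simp),
        shift_eq (n := 0) (by rw [weylGroup_zsmul_delta]; simp)]
    · have e1 := ht.form_apply x hcy'
      have e2 := ht'.form_apply x hcy
      rw [h1, map_add, LinearMap.add_apply] at e1
      rw [h2, map_add, LinearMap.add_apply, A.form_comm y' y] at e2
      have e3 : A.formScale * A.c x * (shift t y' - shift t' y) = 0 := by linarith
      exact sub_eq_zero.1 ((mul_eq_zero.1 e3).resolve_left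
        (mul_ne_zero A.formScale_pos.ne' hx))
  rw [h1, h2, map_add, map_add, ht.apply_eq hcy', ht'.apply_eq hcy, h1, h2, key]
  abel

/-- For `x` of nonzero level, `t x - x` pairs to zero with every root, so it is `n • δ`;
preservation of the norm of `x` then forces `n = 0`. Level zero follows by adding `ρ`. -/
theorem eq_one (ht : IsTranslation t) (h : ∀ i, shift t (A.root i) = 0) : t = 1 := by
  have key : ∀ x, A.c x ≠ 0 → t.1 x = x := by
    intro x hx
    obtain ⟨n, hn⟩ := A.exists_eq_zsmul_delta (fst_weylGroup_sub t x) fun i => by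
      have e := ht.form_apply x (A.c_root i)
      rw [h, mul_zero, zero_mul, sub_zero, A.form_comm, A.form_comm x] at e
      rw [form_root, form_root] at e
      rw [map_sub, mul_left_cancel₀ (A.symmetrizer_pos i).ne' e, sub_self]
    have e := form_weylGroup t x x
    have hd : A.form A.delta A.delta = 0 := by rw [form_delta, c_delta, mul_zero]
    rw [sub_eq_iff_eq_add.1 hn] at e
    simp only [map_add, map_zsmul, LinearMap.add_apply, LinearMap.smul_apply, hd,
      A.form_comm x A.delta, form_delta, smul_eq_mul] at e
    have e' : n * (A.formScale * A.c x) = 0 := by linarith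
    have hn0 := (mul_eq_zero.1 e').resolve_right (mul_ne_zero A.formScale_pos.ne' hx)
    rw [hn0, zero_smul, sub_eq_zero] at hn
    exact hn
  have hρ : 0 < A.c A.rho := by
    rw [c_rho]
    have := A.nonempty
    exact Finset.sum_pos (fun i _ => A.comarks_pos i) Finset.univ_nonempty
  refine Subtype.ext (LinearEquiv.ext fun x => ?_)
  change t.1 x = x
  by_cases hx : A.c x = 0
  · have h1 := key (x + A.rho) (by rw [map_add, hx, zero_add]; exact hρ.ne')
    rw [map_add, key A.rho hρ.ne'] at h1
    exact add_right_cancel h1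
  · exact key x hx

end IsTranslation

/-- Level-zero weights are orthogonal to `δ`, so moving each `t⁻¹ α_i` by multiples of `δ` does not
change their pairings. Hence `t x - x` is orthogonal to all simple roots. -/
theorem isTranslation_of_root {t : A.weylGroup}
    (h : ∀ i, ∃ n : ℤ, t.1 (A.root i) = A.root i + n • A.delta) : IsTranslation t := by
  have hQ : ∀ y : A.WeightLattice, y.1 = 0 → ∃ n : ℤ, t.1 y = y + n • A.delta := by
    intro y hy
    choose n hn using h
    have e : y = ∑ i, y.2 i • A.root i := by
      refine Prod.ext ?_ ?_
      · simp [Prod.fst_sum, root, hy]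
      · funext j
        simp [Prod.snd_sum, root, Finset.sum_apply, Pi.single_apply]
    refine ⟨∑ i, y.2 i * n i, ?_⟩
    calc t.1 y = ∑ i, y.2 i • t.1 (A.root i) := by
          conv_lhs => rw [e]
          simp only [map_sum, map_zsmul]
      _ = ∑ i, y.2 i • A.root i + (∑ i, y.2 i * n i) • A.delta := by
          simp only [hn, Finset.sum_smul, ← Finset.sum_add_distrib, smul_add, mul_smul]
      _ = y + (∑ i, y.2 i * n i) • A.delta := by rw [← e]
  intro x hx
  obtain ⟨n, hn⟩ := A.exists_eq_zsmul_delta (fst_weylGroup_sub t x) fun i => by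
    obtain ⟨m, hm⟩ := hQ (t⁻¹.1 (A.root i)) (by rw [fst_weylGroup]; rfl)
    rw [weylGroup_apply_inv_self] at hm
    have e : A.form x (t⁻¹.1 (A.root i)) = A.form (t.1 x) (A.root i) := by
      rw [← form_weylGroup t, weylGroup_apply_inv_self]
    have e2 : A.form x A.delta = 0 := by rw [form_comm, form_delta, hx, mul_zero]
    rw [← sub_eq_iff_eq_add.2 hm, map_sub, map_zsmul, e2, smul_zero, sub_zero, A.form_comm,
      A.form_comm (t.1 x), form_root, form_root] at e
    rw [map_sub, mul_left_cancel₀ (A.symmetrizer_pos i).ne' e, sub_self]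
  exact ⟨n, by rw [← hn]; abel⟩

variable (A) in
-- The conjugates of a simple root share its norm, so they lie in finitely many classes modulo `δ`.
-- By pigeonhole two distinct group elements agree modulo `δ` on all simple roots, and their
-- quotient is the translation.
theorem exists_isTranslation_ne_one : ∃ t : A.weylGroup, IsTranslation t ∧ t ≠ 1 := by
  have hB : ∀ (w : A.weylGroup) i, A.form (w.1 (A.root i)) (w.1 (A.root i)) =
      2 * A.symmetrizer i := fun w i => by
    rw [form_weylGroup, form_root, coroot_root, A.diag]; ring
  have hfst : ∀ (w : A.weylGroup) i, (w.1 (A.root i)).1 = 0 := fun w i => by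
    rw [fst_weylGroup]; rfl
  choose F hF hrep using fun i => A.exists_finite_reps (2 * A.symmetrizer i)
  choose y hy n hn using fun (w : A.weylGroup) i => hrep i _ (hfst w i) (hB w i).le
  have := fun i => (hF i).to_subtype
  have := A.infinite_weylGroup
  obtain ⟨v, w, hvw, h⟩ := Finite.exists_ne_map_eq_of_infinite
    (fun (w : A.weylGroup) i => (⟨y w i, hy w i⟩ : F i))
  refine ⟨v⁻¹ * w, isTranslation_of_root fun i => ⟨n w i - n v i, ?_⟩,
    fun e => hvw (inv_mul_eq_one.1 e)⟩
  have hi : y v i = y w i := congrArg Subtype.val (congrFun h i)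
  have e : w.1 (A.root i) = v.1 (A.root i) + (n w i - n v i) • A.delta := by
    rw [hn w i, hn v i, hi]; module
  rw [weylGroup_mul_apply, e, map_add, weylGroup_inv_apply_self, weylGroup_zsmul_delta]

variable (A) in
-- Conjugation by `s_i` passes a nonzero shift from `α_i` to any adjacent `α_j`.
theorem exists_shift_root_ne_zero (i : I) :
    ∃ t : A.weylGroup, IsTranslation t ∧ shift t (A.root i) ≠ 0 := by
  obtain ⟨t, ht, ht1⟩ := A.exists_isTranslation_ne_one
  have : ∃ k, shift t (A.root k) ≠ 0 := by
    by_contra! h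
    exact ht1 (ht.eq_one h)
  obtain ⟨k, hk⟩ := this
  refine A.forall_of_adjacent
    (p := fun i => ∃ t : A.weylGroup, IsTranslation t ∧ shift t (A.root i) ≠ 0) k ⟨t, ht, hk⟩ ?_ i
  rintro i j ⟨t, ht, hi⟩ - ha
  by_cases hj : shift t (A.root j) = 0
  · refine ⟨_, ht.conj (A.reflection i), ?_⟩
    rw [ht.shift_conj_reflection i (A.c_root j), hj, coroot_root, zero_sub, neg_ne_zero]
    exact mul_ne_zero ha hi
  · exact ⟨t, ht, hj⟩

/-- Finitely many translations suffice to move every level zero weight that is not fixed by the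
Weyl group. -/
theorem exists_finite_translations : ∃ Θ : Set A.weylGroup, Θ.Finite ∧
    (∀ t ∈ Θ, IsTranslation t) ∧ ∀ x : A.WeightLattice, A.c x = 0 → (∃ i, A.coroot i x ≠ 0) →
      ∃ t ∈ Θ, shift t x ≠ 0 := by
  choose t ht hi using A.exists_shift_root_ne_zero
  -- The shifts of `t i` and of its conjugate at `x` differ by `⟨h_i, x⟩` times the nonzero shift of
  -- `α_i`, so they cannot both vanish when `⟨h_i, x⟩ ≠ 0`.
  refine ⟨Set.range t ∪ Set.range fun i => A.reflection i * t i * (A.reflection i)⁻¹,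
    (Set.finite_range _).union (Set.finite_range _), ?_, ?_⟩
  · rintro _ (⟨i, rfl⟩ | ⟨i, rfl⟩)
    · exact ht i
    · exact (ht i).conj _
  · rintro x hx ⟨i, hxi⟩
    by_cases h : shift (t i) x = 0
    · refine ⟨_, Or.inr ⟨i, rfl⟩, ?_⟩
      simp only [(ht i).shift_conj_reflection i hx, h, zero_sub, neg_ne_zero]
      exact mul_ne_zero hxi (hi i)
    · exact ⟨_, Or.inl ⟨i, rfl⟩, h⟩

/-- In rank at least three there are two independent translations. -/
theorem exists_independent_translations (hI : 2 < Fintype.card I) :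
    ∃ t t' : A.weylGroup, IsTranslation t ∧ IsTranslation t' ∧
      (∃ x, A.c x = 0 ∧ shift t x ≠ 0) ∧ ∃ y, A.c y = 0 ∧ shift t y = 0 ∧ shift t' y ≠ 0 := by
  obtain ⟨t, ht, ht1⟩ := A.exists_isTranslation_ne_one
  have : ∃ k, shift t (A.root k) ≠ 0 := by
    by_contra! h
    exact ht1 (ht.eq_one h)
  obtain ⟨k, hk⟩ := this
  suffices h : ∃ i j, shift t (A.root i) ≠ 0 ∧
      2 * shift t (A.root j) ≠ A.a i j * shift t (A.root i) by
    obtain ⟨i, j, hi, hij⟩ := h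
    refine ⟨t, A.reflection i * t * (A.reflection i)⁻¹, ht, ht.conj _, ⟨_, A.c_root i, hi⟩,
      shift t (A.root j) • A.root i - shift t (A.root i) • A.root j, ?_, ?_, ?_⟩
    · rw [map_sub, map_zsmul, map_zsmul, c_root, c_root, smul_zero, smul_zero, sub_zero]
    · rw [ht.shift_sub_zsmul (by rw [map_zsmul, c_root, smul_zero]) (A.c_root j),
        ht.shift_zsmul (A.c_root i)]
      ring
    · rw [(ht.conj _).shift_sub_zsmul (by rw [map_zsmul, c_root, smul_zero]) (A.c_root j),
        (ht.conj _).shift_zsmul (A.c_root i), ht.shift_conj_reflection i (A.c_root i),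
        ht.shift_conj_reflection i (A.c_root j), coroot_root, coroot_root, A.diag]
      intro h
      have h' : shift t (A.root i) *
          (2 * shift t (A.root j) - A.a i j * shift t (A.root i)) = 0 := by
        linear_combination -h
      rcases mul_eq_zero.1 h' with h' | h'
      · exact hi h'
      · exact hij (sub_eq_zero.1 h')
  -- Otherwise all shifts of simple roots are nonzero and have pairwise opposite signs, impossible
  -- for three indices.
  by_contra! hpar
  have hall : ∀ i, shift t (A.root i) ≠ 0 :=
    A.forall_of_adjacent k hk fun i j hi _ ha h => by
      have := hpar i j hi
      rw [h, mul_zero] at this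
      exact mul_ne_zero ha hi this.symm
  have hsign : ∀ i j, i ≠ j → shift t (A.root i) * shift t (A.root j) ≤ 0 := by
    intro i j hij
    have h1 := hpar i j (hall i)
    have h2 := A.offDiag i j hij
    have h3 : 2 * (shift t (A.root i) * shift t (A.root j)) =
        A.a i j * shift t (A.root i) ^ 2 := by linear_combination shift t (A.root i) * h1
    have h4 := mul_nonpos_of_nonpos_of_nonneg h2 (sq_nonneg (shift t (A.root i)))
    linarith
  obtain ⟨i, j, l, hij, hil, hjl⟩ := Fintype.two_lt_card_iff.1 hI
  have h1 := lt_of_le_of_ne (hsign i j hij) (mul_ne_zero (hall i) (hall j))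
  have h2 := lt_of_le_of_ne (hsign i l hil) (mul_ne_zero (hall i) (hall l))
  have h3 := lt_of_le_of_ne (hsign j l hjl) (mul_ne_zero (hall j) (hall l))
  have h4 := mul_pos_of_neg_of_neg h1 h2
  nlinarith [mul_pos (sq_pos_of_ne_zero (hall i)) (neg_pos.2 h3)]

end

/-! ### Coefficient functions -/

section

variable {I : Type*} [Fintype I] (A : AffineCartanMatrix I) {𝓡 : Type*} [CommRing 𝓡] (q : 𝓡ˣ)

/-- Coefficient functions of finite `𝓡`-linear combinations of the `e^x`, where `e^δ = q`. -/
def coefficientSpace : Submodule 𝓡 (A.WeightLattice → 𝓡) where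
  -- The inverse appears because `e^(x + δ) = q e^x`: one element has coefficient `r` relative to
  -- `e^x` and `q⁻¹ r` relative to `e^(x + δ)`.
  carrier := {u | (∀ x, u (x + A.delta) = ↑q⁻¹ * u x) ∧
    ∃ F : Set A.WeightLattice, F.Finite ∧ ∀ x, u x ≠ 0 → ∃ y ∈ F, ∃ n : ℤ, x = y + n • A.delta}
  zero_mem' := ⟨fun x => by simp, ∅, Set.finite_empty, fun x h => (h rfl).elim⟩
  add_mem' := by
    rintro u v ⟨hu, F, hF, hF'⟩ ⟨hv, G, hG, hG'⟩
    refine ⟨fun x => by simp only [Pi.add_apply, hu, hv, mul_add], F ∪ G, hF.union hG,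
      fun x hx => ?_⟩
    by_cases h : u x = 0
    · obtain ⟨y, hy, h'⟩ := hG' x (fun h' => hx (by simp [h, h']))
      exact ⟨y, Or.inr hy, h'⟩
    · obtain ⟨y, hy, h'⟩ := hF' x h
      exact ⟨y, Or.inl hy, h'⟩
  smul_mem' := by
    rintro r u ⟨hu, F, hF, hF'⟩
    refine ⟨fun x => ?_, F, hF, fun x hx => hF' x fun h => hx (by simp [h])⟩
    simp only [Pi.smul_apply, hu, smul_eq_mul]
    ring

variable {A q}

theorem coefficientSpace_apply_add_zsmul {u : A.WeightLattice → 𝓡}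
    (hu : u ∈ A.coefficientSpace q) (x : A.WeightLattice) (n : ℤ) :
    u (x + n • A.delta) = ((q ^ (-n) : 𝓡ˣ) : 𝓡) * u x := by
  induction n using Int.induction_on with
  | zero => simp
  | succ n ih =>
    rw [add_smul, one_smul, ← add_assoc, hu.1, ih, ← mul_assoc, ← Units.val_mul, ← zpow_neg_one,
      ← zpow_add, neg_add_rev]
  | pred n ih =>
    have h := hu.1 (x + (-(n : ℤ) - 1) • A.delta)
    have e : x + (-(n : ℤ) - 1) • A.delta + A.delta = x + (-(n : ℤ)) • A.delta := by module
    rw [e, ih] at h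
    have h' := congrArg (fun r => (q : 𝓡) * r) h
    simp only [Units.mul_inv_cancel_left] at h'
    rw [← h', ← mul_assoc, ← Units.val_mul, ← zpow_one_add]
    congr 3
    ring

theorem mul_mem_coefficientSpace {u : A.WeightLattice → 𝓡} (hu : u ∈ A.coefficientSpace q)
    {a : A.WeightLattice → 𝓡} (ha : ∀ x, a (x + A.delta) = a x) :
    (fun x => a x * u x) ∈ A.coefficientSpace q := by
  obtain ⟨h, F, hF, hF'⟩ := hu
  refine ⟨fun x => ?_, F, hF, fun x hx => hF' x fun h => hx (by simp [h])⟩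
  simp only [h, ha]
  ring

theorem restrict_mem_coefficientSpace {u : A.WeightLattice → 𝓡} (hu : u ∈ A.coefficientSpace q)
    {S : A.WeightLattice → Prop} [DecidablePred S] (hS : ∀ x, S (x + A.delta) ↔ S x) :
    (fun x => if S x then u x else 0) ∈ A.coefficientSpace q := by
  have := mul_mem_coefficientSpace hu (a := fun x => if S x then 1 else 0)
    (fun x => by simp only [hS])
  simpa using this

theorem finite_image_support {u : A.WeightLattice → 𝓡} (hu : u ∈ A.coefficientSpace q)
    {β : Type*} (g : A.WeightLattice → β) (hg : ∀ x (n : ℤ), g (x + n • A.delta) = g x) :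
    {b | ∃ x, g x = b ∧ u x ≠ 0}.Finite := by
  obtain ⟨-, F, hF, hF'⟩ := hu
  refine (hF.image g).subset ?_
  rintro _ ⟨x, rfl, hx⟩
  obtain ⟨y, hy, n, rfl⟩ := hF' x hx
  exact ⟨y, hy, (hg y n).symm⟩

theorem c_add_delta (x : A.WeightLattice) : A.c (x + A.delta) = A.c x := by
  rw [map_add, c_delta, add_zero]

theorem coroot_add_delta (i : I) (x : A.WeightLattice) :
    A.coroot i (x + A.delta) = A.coroot i x := by
  rw [map_add, coroot_delta, add_zero]

theorem form_add_zsmul_delta (x : A.WeightLattice) (n : ℤ) {y : A.WeightLattice}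
    (hy : A.c y = 0) : A.form (x + n • A.delta) y = A.form x y := by
  rw [map_add, map_zsmul, LinearMap.add_apply, LinearMap.smul_apply, form_delta, hy, mul_zero,
    smul_zero, add_zero]

theorem c_add_zsmul_delta (x : A.WeightLattice) (n : ℤ) : A.c (x + n • A.delta) = A.c x := by
  rw [map_add, map_zsmul, c_delta, smul_zero, add_zero]

variable (A q) in
open Classical in
/-- The coefficient function of `e^y`: its value at `x` is `q ^ n` if `y = x + n δ`. -/
noncomputable def monomial (y x : A.WeightLattice) : 𝓡 :=
  if h : ∃ n : ℤ, y = x + n • A.delta then ((q ^ h.choose : 𝓡ˣ) : 𝓡) else 0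

theorem monomial_add_zsmul (x : A.WeightLattice) (n : ℤ) :
    A.monomial q (x + n • A.delta) x = ((q ^ n : 𝓡ˣ) : 𝓡) := by
  have h : ∃ m : ℤ, x + n • A.delta = x + m • A.delta := ⟨n, rfl⟩
  rw [monomial, dif_pos h, A.zsmul_delta_injective (add_left_cancel h.choose_spec).symm]

theorem monomial_eq {x y : A.WeightLattice} {n : ℤ} (h : y = x + n • A.delta) :
    A.monomial q y x = ((q ^ n : 𝓡ˣ) : 𝓡) := by
  rw [h, monomial_add_zsmul]

theorem monomial_eq_zero {x y : A.WeightLattice} (h : ¬ ∃ n : ℤ, y = x + n • A.delta) :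
    A.monomial q y x = 0 := by
  rw [monomial, dif_neg h]

theorem monomial_mem (y : A.WeightLattice) : A.monomial q y ∈ A.coefficientSpace q := by
  refine ⟨fun x => ?_, {y}, Set.finite_singleton y, fun x hx => ?_⟩
  · by_cases h : ∃ n : ℤ, y = x + n • A.delta
    · obtain ⟨n, hn⟩ := h
      rw [monomial_eq hn, monomial_eq (n := -1 + n) (by rw [hn]; module), zpow_add, zpow_neg_one,
        Units.val_mul]
    · rw [monomial_eq_zero h, monomial_eq_zero, mul_zero]
      rintro ⟨n, hn⟩
      exact h ⟨n + 1, by rw [hn]; module⟩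
  · by_contra h
    refine hx (monomial_eq_zero ?_)
    rintro ⟨n, hn⟩
    exact h ⟨y, rfl, -n, by rw [hn]; module⟩

theorem monomial_add_zsmul_left (y x : A.WeightLattice) (n : ℤ) :
    A.monomial q (y + n • A.delta) x = ((q ^ n : 𝓡ˣ) : 𝓡) * A.monomial q y x := by
  by_cases h : ∃ m : ℤ, y = x + m • A.delta
  · obtain ⟨m, rfl⟩ := h
    rw [monomial_eq (n := n + m) (by module), monomial_eq rfl, zpow_add, Units.val_mul]
  · rw [monomial_eq_zero h, monomial_eq_zero, mul_zero]
    rintro ⟨m, hm⟩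
    exact h ⟨m - n, by rw [sub_smul, ← add_sub_assoc, ← hm]; abel⟩

/-- Induction principle: coefficient functions are sums of multiples of monomials. -/
theorem coefficientSpace_induction {p : (A.WeightLattice → 𝓡) → Prop} {D : A.WeightLattice → Prop}
    (zero : p 0) (add : ∀ u v, p u → p v → p (u + v))
    (smul : ∀ (r : 𝓡) y, D y → p (r • A.monomial q y)) {u : A.WeightLattice → 𝓡}
    (hu : u ∈ A.coefficientSpace q) (hD : ∀ x, u x ≠ 0 → D x) : p u := by
  classical
  obtain ⟨F, hF, hF'⟩ := hu.2
  induction F, hF using Set.Finite.induction_on generalizing u with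
  | empty =>
    have : u = 0 := by
      funext x
      by_contra h
      obtain ⟨y, hy, -⟩ := hF' x h
      exact hy
    exact this ▸ zero
  | @insert y F _ _ ih =>
    -- Off the coset of `y`. The part of `u` on that coset is a multiple of one monomial, and the
    -- rest has fewer cosets in its support.
    let S : A.WeightLattice → Prop := fun x => ¬ ∃ n : ℤ, y = x + n • A.delta
    have hS : ∀ x, S (x + A.delta) ↔ S x := fun x => not_congr
      ⟨fun ⟨n, hn⟩ => ⟨n + 1, by rw [hn]; module⟩, fun ⟨n, hn⟩ => ⟨n - 1, by rw [hn]; module⟩⟩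
    have hrest : p (fun x => if S x then u x else 0) := by
      refine ih (restrict_mem_coefficientSpace hu hS) (fun x hx => ?_) fun x hx => ?_
      · by_cases h : S x
        · rw [if_pos h] at hx
          exact hD x hx
        · rw [if_neg h] at hx
          exact (hx rfl).elim
      · by_cases h : S x
        · rw [if_pos h] at hx
          obtain ⟨z, hz | hz, n, rfl⟩ := hF' x hx
          · exact (h ⟨-n, by rw [hz]; module⟩).elim
          · exact ⟨z, hz, n, rfl⟩
        · rw [if_neg h] at hx
          exact (hx rfl).elim
    by_cases hy : u y = 0
    · convert hrest using 2 with x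
      by_cases h : S x
      · rw [if_pos h]
      · rw [if_neg h]
        obtain ⟨n, hn⟩ := not_not.1 h
        rw [show x = y + (-n) • A.delta by rw [hn]; module, coefficientSpace_apply_add_zsmul hu,
          hy, mul_zero]
    · have e : u = u y • A.monomial q y + fun x => if S x then u x else 0 := by
        funext x
        by_cases h : S x
        · simp only [Pi.add_apply, Pi.smul_apply, if_pos h]
          rw [monomial_eq_zero h, smul_zero, zero_add]
        · simp only [Pi.add_apply, Pi.smul_apply, if_neg h, add_zero]
          obtain ⟨n, hn⟩ := not_not.1 h
          rw [monomial_eq hn, show x = y + (-n) • A.delta by rw [hn]; module,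
            coefficientSpace_apply_add_zsmul hu, neg_neg, smul_eq_mul, mul_comm]
      rw [e]
      exact add _ _ (smul _ _ (hD y hy)) hrest

variable [DecidableEq I]

theorem comp_mem_coefficientSpace {u : A.WeightLattice → 𝓡} (hu : u ∈ A.coefficientSpace q)
    (w : A.weylGroup) : (fun x => u (w.1 x)) ∈ A.coefficientSpace q := by
  obtain ⟨h, F, hF, hF'⟩ := hu
  refine ⟨fun x => ?_, (fun x => w⁻¹.1 x) '' F, hF.image _, fun x hx => ?_⟩
  · simp only [map_add, weylGroup_delta, h]
  · obtain ⟨y, hy, n, hn⟩ := hF' _ hx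
    refine ⟨_, ⟨y, hy, rfl⟩, n, ?_⟩
    change x = w⁻¹.1 y + n • A.delta
    rw [← weylGroup_zsmul_delta w⁻¹, ← map_add, ← hn, weylGroup_inv_apply_self]

theorem monomial_weylGroup (w : A.weylGroup) (y x : A.WeightLattice) :
    A.monomial q (w.1 y) x = A.monomial q y (w⁻¹.1 x) := by
  by_cases h : ∃ n : ℤ, y = w⁻¹.1 x + n • A.delta
  · obtain ⟨n, hn⟩ := h
    rw [monomial_eq hn, monomial_eq (n := n)]
    rw [hn, map_add, weylGroup_apply_inv_self, weylGroup_zsmul_delta]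
  · rw [monomial_eq_zero h, monomial_eq_zero]
    rintro ⟨n, hn⟩
    refine h ⟨n, ?_⟩
    rw [← weylGroup_inv_apply_self w y, hn, map_add, weylGroup_zsmul_delta]

/-! ### Cocycles and their primitives at level zero -/

variable (A q) in
/-- One-cocycles of the Weyl group with values in the coefficient space. -/
structure IsCocycle (F : A.weylGroup → A.WeightLattice → 𝓡) : Prop where
  mem : ∀ w, F w ∈ A.coefficientSpace q
  mul : ∀ v w x, F (v * w) x = F w (v⁻¹.1 x) + F v x

variable {F : A.weylGroup → A.WeightLattice → 𝓡}

namespace IsCocycle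

theorem one (hF : A.IsCocycle q F) (x : A.WeightLattice) : F 1 x = 0 := by
  have := hF.mul 1 1 x
  rw [mul_one, inv_one, weylGroup_one_apply] at this
  exact left_eq_add.1 this

theorem sub_coboundary (hF : A.IsCocycle q F) {u : A.WeightLattice → 𝓡}
    (hu : u ∈ A.coefficientSpace q) :
    A.IsCocycle q fun w x => F w x - (u (w⁻¹.1 x) - u x) where
  mem w := sub_mem (hF.mem w) (sub_mem (comp_mem_coefficientSpace hu w⁻¹) hu)
  mul v w x := by
    rw [hF.mul, mul_inv_rev, weylGroup_mul_apply]
    ring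

theorem restrict (hF : A.IsCocycle q F) {S : A.WeightLattice → Prop} [DecidablePred S]
    (hS : ∀ x, S (x + A.delta) ↔ S x) (hS' : ∀ (w : A.weylGroup) x, S (w.1 x) ↔ S x) :
    A.IsCocycle q fun w x => if S x then F w x else 0 where
  mem w := restrict_mem_coefficientSpace (hF.mem w) hS
  mul v w x := by
    by_cases h : S x
    · simp only [hS', if_pos h, hF.mul]
    · simp only [hS', if_neg h, add_zero]

theorem eq_zero_of_reflection (hF : A.IsCocycle q F) (h : ∀ i x, F (A.reflection i) x = 0)
    (w : A.weylGroup) (x : A.WeightLattice) : F w x = 0 := by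
  induction w using weylGroup_induction generalizing x with
  | refl i => exact h i x
  | one => exact hF.one x
  | mul v w hv hw => rw [hF.mul, hv, hw, add_zero]
  | inv w hw =>
    have := hF.mul w w⁻¹ (w.1 x)
    rw [mul_inv_cancel, hF.one, hw, add_zero, weylGroup_inv_apply_self] at this
    exact this.symm

theorem reflection_apply_add (hF : A.IsCocycle q F) (i : I) (x : A.WeightLattice) :
    F (A.reflection i) ((A.reflection i).1 x) + F (A.reflection i) x = 0 := by
  have := hF.mul (A.reflection i) (A.reflection i) x
  rw [reflection_mul_self, hF.one, reflection_inv] at this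
  exact this.symm

theorem reflection_eq_zero (hF : A.IsCocycle q F) (h2 : ∀ r : 𝓡, r + r = 0 → r = 0) (i : I)
    {x : A.WeightLattice} (hx : A.coroot i x = 0) : F (A.reflection i) x = 0 := by
  have := hF.reflection_apply_add i x
  rw [reflection_apply, hx, zero_smul, sub_zero] at this
  exact h2 _ this

theorem eq_zero_of_fixed (hF : A.IsCocycle q F) (h2 : ∀ r : 𝓡, r + r = 0 → r = 0)
    {x : A.WeightLattice} (hx : ∀ i, A.coroot i x = 0) (w : A.weylGroup) : F w x = 0 := by
  induction w using weylGroup_induction with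
  | refl i => exact hF.reflection_eq_zero h2 i (hx i)
  | one => exact hF.one x
  | mul v w hv hw => rw [hF.mul, weylGroup_apply_eq_self _ hx, hv, hw, add_zero]
  | inv w hw =>
    have := hF.mul w w⁻¹ x
    rw [mul_inv_cancel, hF.one, hw, add_zero, weylGroup_apply_eq_self _ hx] at this
    exact this.symm

/-- On level zero weights a cocycle is a coboundary. -/
theorem exists_primitive_level_zero (hF : A.IsCocycle q F) (h2 : ∀ r : 𝓡, r + r = 0 → r = 0)
    (hq : ∀ n : ℤ, n ≠ 0 → IsUnit (((q ^ n : 𝓡ˣ) : 𝓡) - 1)) :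
    ∃ u ∈ A.coefficientSpace q, (∀ x, A.c x ≠ 0 → u x = 0) ∧
      ∀ w x, A.c x = 0 → F w x = u (w⁻¹.1 x) - u x := by
  classical
  obtain ⟨Θ, hΘ, hΘt, hΘx⟩ := exists_finite_translations (A := A)
  let S : A.WeightLattice → Prop := fun x => A.c x = 0 ∧ ∃ i, A.coroot i x ≠ 0
  have hact : ∀ {u : A.WeightLattice → 𝓡}, u ∈ A.coefficientSpace q → ∀ {t : A.weylGroup},
      IsTranslation t → ∀ x, A.c x = 0 → u (t⁻¹.1 x) = ((q ^ shift t x : 𝓡ˣ) : 𝓡) * u x := by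
    intro u hu t ht x hx
    rw [ht.inv_apply_eq hx, sub_eq_add_neg, ← neg_smul, coefficientSpace_apply_add_zsmul hu,
      neg_neg]
  -- The value is `F θ x / (q ^ shift θ x - 1)` for one `θ` with nonzero shift; expanding `F (t * θ)
  -- = F (θ * t)` shows that it serves every translation.
  have hex : ∀ x, ∃ r : 𝓡, (¬ S x → r = 0) ∧ (S x → ∀ t : A.weylGroup, IsTranslation t →
      F t x = (((q ^ shift t x : 𝓡ˣ) : 𝓡) - 1) * r) := by
    intro x
    by_cases hx : S x
    · obtain ⟨θ, hθ, hs⟩ := hΘx x hx.1 hx.2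
      obtain ⟨v, hv⟩ := hq _ hs
      refine ⟨↑v⁻¹ * F θ x, fun h => (h hx).elim, fun _ t ht => ?_⟩
      have h1 := hF.mul t θ x
      rw [ht.commute (hΘt θ hθ), hF.mul, hact (hF.mem _) (hΘt θ hθ) x hx.1,
        hact (hF.mem _) ht x hx.1] at h1
      have h3 : (v : 𝓡) * F t x = (((q ^ shift t x : 𝓡ˣ) : 𝓡) - 1) * F θ x := by
        rw [hv]
        linear_combination h1
      rw [← Units.inv_mul_cancel_left v (F t x), h3]
      ring
    · exact ⟨0, fun _ => rfl, fun h => (hx h).elim⟩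
  choose u hu0 hu using hex
  have hSδ : ∀ x, S (x + A.delta) ↔ S x := fun x => by
    simp only [S, c_add_delta, coroot_add_delta]
  have hmem : u ∈ A.coefficientSpace q := by
    constructor
    · intro x
      by_cases hx : S x
      · obtain ⟨θ, hθ, hs⟩ := hΘx x hx.1 hx.2
        have h1 := hu (x + A.delta) ((hSδ x).2 hx) θ (hΘt θ hθ)
        have h3 : shift θ (x + A.delta) = shift θ x := shift_eq (by
          rw [map_add, weylGroup_delta, (hΘt θ hθ).apply_eq hx.1]; abel)
        rw [(hF.mem θ).1, h3, hu x hx θ (hΘt θ hθ)] at h1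
        refine (hq _ hs).mul_left_cancel ?_
        rw [← h1]
        ring
      · rw [hu0 x hx, hu0 _ (fun h => hx ((hSδ x).1 h)), mul_zero]
    · choose G hG hG' using fun t => (hF.mem t).2
      -- Finiteness of `Θ` keeps the support of the primitive finite modulo `δ`.
      refine ⟨⋃ t ∈ Θ, G t, hΘ.biUnion fun t _ => hG t, fun x hx => ?_⟩
      have hSx : S x := by
        by_contra h
        exact hx (hu0 x h)
      obtain ⟨θ, hθ, hs⟩ := hΘx x hSx.1 hSx.2
      obtain ⟨y, hy, h⟩ := hG' θ x fun h => by
        rw [hu x hSx θ (hΘt θ hθ)] at h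
        exact hx ((hq _ hs).mul_right_eq_zero.1 h)
      exact ⟨y, Set.mem_biUnion hθ hy, h⟩
  refine ⟨u, hmem, fun x hx => hu0 x fun h => hx h.1, fun w x hx => ?_⟩
  by_cases hS : S x
  · have hG := hF.sub_coboundary hmem
    have hGt : ∀ t : A.weylGroup, IsTranslation t → ∀ y, S y → F t y - (u (t⁻¹.1 y) - u y) = 0 := by
      intro t ht y hy
      rw [hact hmem ht y hy.1, hu y hy t ht]
      ring
    have hSw : S (w⁻¹.1 x) := by
      refine ⟨(A.c_weylGroup _ _).trans hx, ?_⟩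
      by_contra! h
      obtain ⟨i, hi⟩ := hS.2
      have h' := weylGroup_apply_eq_self w h
      rw [weylGroup_apply_inv_self] at h'
      exact hi (h' ▸ h i)
    obtain ⟨θ, hθ, hs⟩ := hΘx x hx hS.2
    have hθt := hΘt θ hθ
    -- The corrected cocycle vanishes on `θ` and on `w⁻¹ * θ * w`, so its value at `w` is
    -- `θ`-invariant. At `x` this says that it is killed by the unit `q ^ shift θ x - 1`.
    have hconj := hθt.conj w⁻¹
    rw [inv_inv] at hconj
    have h1 := hG.mul θ w x
    rw [show θ * w = w * (w⁻¹ * θ * w) by group, hG.mul] at h1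
    rw [hGt _ hconj _ hSw, hGt θ hθt x hS, zero_add, add_zero] at h1
    have h3 := hact (hG.mem w) hθt x hx
    rw [h3] at h1
    have h4 : (((q ^ shift θ x : 𝓡ˣ) : 𝓡) - 1) * (F w x - (u (w⁻¹.1 x) - u x)) = 0 := by
      linear_combination -h1
    exact sub_eq_zero.1 ((hq _ hs).mul_right_eq_zero.1 h4)
  · have hfix : ∀ i, A.coroot i x = 0 := fun i => by
      by_contra h
      exact hS ⟨hx, i, h⟩
    rw [hF.eq_zero_of_fixed h2 hfix, weylGroup_apply_eq_self _ hfix, sub_self]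

end IsCocycle

/-! ### Nonzero level in rank at least three -/

theorem IsTranslation.form_inv_apply {t : A.weylGroup} (ht : IsTranslation t)
    (x : A.WeightLattice) {y : A.WeightLattice} (hy : A.c y = 0) :
    A.form (t⁻¹.1 x) y = A.form x y + A.formScale * shift t y * A.c x := by
  have h := ht.form_apply (t⁻¹.1 x) hy
  rw [weylGroup_apply_inv_self, c_weylGroup] at h
  linarith

/-- Away from level zero nontrivial translations have no invariants. -/
theorem IsTranslation.eq_zero_of_invariant {t : A.weylGroup} (ht : IsTranslation t)
    {y : A.WeightLattice} (hy : A.c y = 0) (hty : shift t y ≠ 0) {u : A.WeightLattice → 𝓡}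
    (hu : u ∈ A.coefficientSpace q) (h : ∀ x, u (t⁻¹.1 x) = u x) {x : A.WeightLattice}
    (hx : A.c x ≠ 0) : u x = 0 := by
  by_contra hne
  -- Iterating `t⁻¹` stays in the support while the pairing with `y` runs through an infinite
  -- arithmetic progression.
  have hiter : ∀ n : ℕ, ∃ z, A.form z y = A.form x y + n * (A.formScale * shift t y * A.c x) ∧
      A.c z = A.c x ∧ u z ≠ 0 := by
    intro n
    induction n with
    | zero => exact ⟨x, by simp, rfl, hne⟩
    | succ n ih =>
      obtain ⟨z, hz, hc, hz'⟩ := ih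
      refine ⟨t⁻¹.1 z, ?_, (A.c_weylGroup _ _).trans hc, by rwa [h]⟩
      rw [ht.form_inv_apply z hy, hz, hc]
      push_cast
      ring
  refine Set.infinite_of_injective_forall_mem
    (f := fun n : ℕ => A.form x y + n * (A.formScale * shift t y * A.c x)) ?_ ?_
    (finite_image_support hu (fun z => A.form z y) fun z n => form_add_zsmul_delta z n hy)
  · intro m n hmn
    have h0 : A.formScale * shift t y * A.c x ≠ 0 :=
      mul_ne_zero (mul_ne_zero A.formScale_pos.ne' hty) hx
    exact_mod_cast mul_right_cancel₀ h0 (add_left_cancel hmn)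
  · intro n
    obtain ⟨z, hz, -, hz'⟩ := hiter n
    exact ⟨z, hz, hz'⟩

/-- Two independent translations form a regular sequence away from level zero. -/
theorem IsTranslation.exists_antidifference {t t' : A.weylGroup} (ht : IsTranslation t)
    (ht' : IsTranslation t') {y : A.WeightLattice} (hy : A.c y = 0) (hty : shift t y = 0)
    (hty' : shift t' y ≠ 0) {a b : A.WeightLattice → 𝓡} (ha : a ∈ A.coefficientSpace q)
    (hb : b ∈ A.coefficientSpace q) (hb0 : ∀ x, A.c x = 0 → b x = 0)
    (h : ∀ x, b (t'⁻¹.1 x) - b x = a (t⁻¹.1 x) - a x) :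
    ∃ u ∈ A.coefficientSpace q, ∀ x, b x = u (t⁻¹.1 x) - u x := by
  classical
  let g : A.WeightLattice → ℤ × ℤ := fun x => (A.c x, A.form x y)
  have hg : ∀ x (n : ℤ), g (x + n • A.delta) = g x := fun x n => by
    simp only [g, c_add_zsmul_delta, form_add_zsmul_delta x n hy]
  have hgδ : ∀ γ x, g (x + A.delta) = γ ↔ g x = γ := fun γ x => by
    have := hg x 1
    rw [one_smul] at this
    rw [this]
  have hgt : ∀ x, g (t⁻¹.1 x) = g x := fun x => by
    simp only [g, c_weylGroup, ht.form_inv_apply x hy, hty, mul_zero, zero_mul, add_zero]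
  let d : ℤ := A.formScale * shift t' y
  have hd : d ≠ 0 := mul_ne_zero A.formScale_pos.ne' hty'
  have hgt' : ∀ x, g (t'⁻¹.1 x) = (A.c x, A.form x y + d * A.c x) := fun x => by
    simp only [g, c_weylGroup, ht'.form_inv_apply x hy, d]
  -- `Good γ`: the piece of `b` in degree `γ` lies in the image of `t - 1`. The degree is preserved
  -- by `t⁻¹`, whereas `t'⁻¹` adds `d * k` to its second entry at level `k`.
  let Good : ℤ × ℤ → Prop := fun γ => ∃ u ∈ A.coefficientSpace q,
    ∀ x, (if g x = γ then b x else 0) = u (t⁻¹.1 x) - u x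
  have hcomm : ∀ x, t⁻¹.1 (t'⁻¹.1 x) = t'⁻¹.1 (t⁻¹.1 x) := fun x => by
    rw [← weylGroup_mul_apply, ← weylGroup_mul_apply, ← mul_inv_rev, ← mul_inv_rev,
      ht.commute ht']
  -- The relation `h` expresses `b` in degree `(k, m)` through `b ∘ t'⁻¹`, whose values come from
  -- degree `(k, m + d * k)`, minus the `t`-difference of `a`.
  have hstep : ∀ k m, Good (k, m + d * k) → Good (k, m) := by
    rintro k m ⟨u, hu, hu'⟩
    refine ⟨(fun x => u (t'⁻¹.1 x)) - (fun x => if g x = (k, m) then a x else 0),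
      sub_mem (comp_mem_coefficientSpace hu _) (restrict_mem_coefficientSpace ha (hgδ _)),
      fun x => ?_⟩
    have hx := hu' (t'⁻¹.1 x)
    simp only [Pi.sub_apply, hgt, ← hcomm]
    by_cases hgx : g x = (k, m)
    · have h1 : A.c x = k := congrArg Prod.fst hgx
      have h2 : A.form x y = m := congrArg Prod.snd hgx
      rw [hgt', h1, h2, if_pos rfl] at hx
      simp only [if_pos hgx]
      linear_combination hx - h x
    · have h1 : g (t'⁻¹.1 x) ≠ (k, m + d * k) := fun h' => by
        rw [hgt'] at h'
        have h1 : A.c x = k := congrArg Prod.fst h'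
        have h2 : A.form x y + d * A.c x = m + d * k := congrArg Prod.snd h'
        rw [h1] at h2
        exact hgx (Prod.ext h1 (add_right_cancel h2))
      rw [if_neg h1] at hx
      simp only [if_neg hgx]
      linear_combination hx
  have hfin := finite_image_support hb g hg
  have hgood : ∀ γ, Good γ := by
    rintro ⟨k, m⟩
    by_contra hbad
    by_cases hk : k = 0
    · refine hbad ⟨0, zero_mem _, fun x => ?_⟩
      by_cases hgx : g x = (k, m)
      · rw [if_pos hgx, hb0 x ((congrArg Prod.fst hgx).trans hk)]
        simp
      · simp [if_neg hgx]
    -- One bad degree makes a whole progression bad, but `b` vanishes in all but finitely many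
    -- degrees and zero pieces are good.
    · have hall : ∀ n : ℕ, ¬ Good (k, m + n * (d * k)) := by
        intro n
        induction n with
        | zero => simpa using hbad
        | succ n ih =>
          refine fun h' => ih (hstep _ _ ?_)
          convert h' using 2
          push_cast
          ring
      refine Set.infinite_of_injective_forall_mem (f := fun n : ℕ => (k, m + n * (d * k))) ?_ ?_
        hfin
      · intro n n' hnn
        exact_mod_cast mul_right_cancel₀ (mul_ne_zero hd hk)
          (add_left_cancel (congrArg Prod.snd hnn))
      · intro n
        by_contra hn
        refine hall n ⟨0, zero_mem _, fun x => ?_⟩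
        by_cases hgx : g x = (k, m + n * (d * k))
        · have : b x = 0 := by
            by_contra hbx
            exact hn ⟨x, hgx, hbx⟩
          simp [this]
        · simp [if_neg hgx]
  choose u hu hu' using hgood
  refine ⟨∑ γ ∈ hfin.toFinset, u γ, sum_mem fun γ _ => hu γ, fun x => ?_⟩
  rw [Finset.sum_apply, Finset.sum_apply, ← Finset.sum_sub_distrib]
  simp only [← hu']
  rw [Finset.sum_ite_eq]
  split_ifs with hx
  · rfl
  · by_contra hbx
    exact hx (hfin.mem_toFinset.2 ⟨x, rfl, hbx⟩)

namespace IsCocycle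

/-- In rank at least three, cocycles supported away from level zero are coboundaries. -/
theorem exists_primitive_of_two_lt_card (hF : A.IsCocycle q F) (hI : 2 < Fintype.card I)
    (hF0 : ∀ w x, A.c x = 0 → F w x = 0) :
    ∃ u ∈ A.coefficientSpace q, ∀ w x, F w x = u (w⁻¹.1 x) - u x := by
  classical
  obtain ⟨t, t', ht, ht', ⟨z, hz, htz⟩, y, hy, hty, hty'⟩ := exists_independent_translations hI
  obtain ⟨u, hu, hut⟩ := ht.exists_antidifference ht' hy hty hty' (hF.mem t') (hF.mem t)
    (hF0 t) fun x => by
      have h1 := hF.mul t t' x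
      rw [ht.commute ht', hF.mul] at h1
      linear_combination h1
  let v : A.WeightLattice → 𝓡 := fun x => if A.c x ≠ 0 then u x else 0
  have hv : v ∈ A.coefficientSpace q :=
    restrict_mem_coefficientSpace (S := fun x => A.c x ≠ 0) hu fun x => by rw [c_add_delta]
  have hG := hF.sub_coboundary hv
  have hG0 : ∀ w x, A.c x = 0 → F w x - (v (w⁻¹.1 x) - v x) = 0 := fun w x hx => by
    have h1 : v x = 0 := if_neg (not_not.2 hx)
    have h2 : v (w⁻¹.1 x) = 0 := if_neg (not_not.2 ((A.c_weylGroup _ _).trans hx))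
    rw [h1, h2, hF0 w x hx, sub_zero, sub_zero]
  have hGt : ∀ x, F t x - (v (t⁻¹.1 x) - v x) = 0 := fun x => by
    by_cases hx : A.c x = 0
    · exact hG0 t x hx
    · have h1 : v x = u x := if_pos hx
      have h2 : v (t⁻¹.1 x) = u (t⁻¹.1 x) := if_pos (by rwa [c_weylGroup])
      rw [h1, h2, hut, sub_self]
  -- Vanishing at `t` spreads to the translations, which commute with `t`, and then to any `w`, as
  -- `w⁻¹ * t * w` is again a translation. In both cases the value is `t`-invariant, hence zero.
  have hcomm : ∀ s : A.weylGroup, IsTranslation s → ∀ x, F s x - (v (s⁻¹.1 x) - v x) = 0 := by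
    intro s hs x
    by_cases hx : A.c x = 0
    · exact hG0 s x hx
    · refine ht.eq_zero_of_invariant hz htz (hG.mem s) (fun x => ?_) hx
      have h1 := hG.mul t s x
      rw [ht.commute hs, hG.mul] at h1
      rw [hGt, hGt, zero_add, add_zero] at h1
      exact h1.symm
  refine ⟨v, hv, fun w x => sub_eq_zero.1 ?_⟩
  by_cases hx : A.c x = 0
  · exact hG0 w x hx
  · refine ht.eq_zero_of_invariant hz htz (hG.mem w) (fun x => ?_) hx
    have hconj := ht.conj w⁻¹
    rw [inv_inv] at hconj
    have h1 := hG.mul t w x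
    rw [show t * w = w * (w⁻¹ * t * w) by group, hG.mul] at h1
    rw [hGt, hcomm _ hconj, zero_add, add_zero] at h1
    exact h1.symm

/-! ### Nonzero level in rank two, and the combined result -/

theorem exists_reflection_primitive (hF : A.IsCocycle q F) (h2 : ∀ r : 𝓡, r + r = 0 → r = 0)
    (i : I) : ∃ u ∈ A.coefficientSpace q,
      (∀ x, u x ≠ 0 → F (A.reflection i) x ≠ 0) ∧
      ∀ x, F (A.reflection i) x = u ((A.reflection i).1 x) - u x := by
  classical
  -- `F (s_i)` is anti-invariant under `s_i` and zero on the wall, so it is recovered from its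
  -- restriction to the positive side.
  refine ⟨-fun x => if 0 < A.coroot i x then F (A.reflection i) x else 0,
    neg_mem (restrict_mem_coefficientSpace (S := fun x => 0 < A.coroot i x) (hF.mem _)
      fun x => by rw [coroot_add_delta]),
    fun x hx h => hx (by simp [h]), fun x => ?_⟩
  have hs : A.coroot i ((A.reflection i).1 x) = -A.coroot i x := by
    rw [reflection_apply, map_sub, map_zsmul, coroot_root, A.diag, smul_eq_mul]
    ring
  have hadd := hF.reflection_apply_add i x
  simp only [Pi.neg_apply, hs]
  rcases lt_trichotomy (A.coroot i x) 0 with h | h | h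
  · rw [if_pos (by linarith), if_neg (by linarith)]
    linear_combination hadd
  · rw [h, hF.reflection_eq_zero h2 i h]
    simp
  · rw [if_neg (by linarith), if_pos h]
    ring

end IsCocycle

/-- In rank two, Weyl orbits of small nonzero level contain a weight on a wall. -/
theorem wall_induction {i j : I} (hij : i ≠ j) (hall : ∀ k, k = i ∨ k = j)
    {E : A.WeightLattice → Prop} (hwall : ∀ k x, A.coroot k x = 0 → E x)
    (hrefl : ∀ k x, E ((A.reflection k).1 x) → E x) (x : A.WeightLattice) (hx : A.c x ≠ 0)
    (hx' : |A.c x| < A.dualCoxeterNumber) : E x := by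
  have huniv : (Finset.univ : Finset I) = {i, j} := by
    ext k
    simpa using hall k
  have hc : ∀ x, A.c x = A.comarks i * A.coroot i x + A.comarks j * A.coroot j x := fun x => by
    rw [c_apply, huniv, Finset.sum_pair hij]
  have hκ : A.dualCoxeterNumber = A.comarks i + A.comarks j := by
    rw [dualCoxeterNumber, c_rho, huniv, Finset.sum_pair hij]
  have hself : ∀ k x, A.coroot k ((A.reflection k).1 x) = -A.coroot k x := fun k x => by
    rw [reflection_apply, map_sub, map_zsmul, coroot_root, A.diag, smul_eq_mul]
    ring
  have hi := A.comarks_pos i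
  have hj := A.comarks_pos j
  -- The two terms sum to `c x`. Off the walls, equal signs would give `|c x| ≥ κ*`, so the signs
  -- differ; the absolute values differ because `c x ≠ 0`. Reflecting in the index of the smaller
  -- term then decreases `N`.
  generalize hN : (A.comarks i * A.coroot i x).natAbs + (A.comarks j * A.coroot j x).natAbs = N
  induction N using Nat.strong_induction_on generalizing x with
  | _ N ih =>
    by_cases hi0 : A.coroot i x = 0
    · exact hwall i x hi0
    by_cases hj0 : A.coroot j x = 0
    · exact hwall j x hj0
    have e1 := hc x
    have e2 := hc ((A.reflection i).1 x)
    have e3 := hc ((A.reflection j).1 x)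
    rw [c_weylGroup, hself, mul_neg] at e2 e3
    have hXi : 0 < A.coroot i x → A.comarks i ≤ A.comarks i * A.coroot i x :=
      fun h => le_mul_of_one_le_right hi.le h
    have hXi' : A.coroot i x < 0 → A.comarks i * A.coroot i x ≤ -A.comarks i := fun h => by
      nlinarith
    have hXj : 0 < A.coroot j x → A.comarks j ≤ A.comarks j * A.coroot j x :=
      fun h => le_mul_of_one_le_right hj.le h
    have hXj' : A.coroot j x < 0 → A.comarks j * A.coroot j x ≤ -A.comarks j := fun h => by
      nlinarith
    have hri := fun h => hrefl i x (ih _ h _ (by rwa [c_weylGroup]) (by rwa [c_weylGroup]) rfl)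
    have hrj := fun h => hrefl j x (ih _ h _ (by rwa [c_weylGroup]) (by rwa [c_weylGroup]) rfl)
    rw [hself, mul_neg] at hri hrj
    rw [hκ, abs_lt] at hx'
    obtain ⟨hx1, hx2⟩ := hx'
    by_cases hlt : (A.comarks i * A.coroot i x).natAbs < (A.comarks j * A.coroot j x).natAbs
    · apply hri
      rw [← hN]
      omega
    · apply hrj
      rw [← hN]
      omega

namespace IsCocycle

/-- In rank two, cocycles supported on small nonzero levels are coboundaries. -/
theorem exists_primitive_of_card_eq_two (hF : A.IsCocycle q F)
    (h2 : ∀ r : 𝓡, r + r = 0 → r = 0) {i j : I} (hij : i ≠ j) (hall : ∀ k, k = i ∨ k = j)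
    (hF0 : ∀ w x, F w x ≠ 0 → A.c x ≠ 0 ∧ |A.c x| < A.dualCoxeterNumber) :
    ∃ u ∈ A.coefficientSpace q, ∀ w x, F w x = u (w⁻¹.1 x) - u x := by
  obtain ⟨v, hv, hv0, hvF⟩ := hF.exists_reflection_primitive h2 i
  obtain ⟨v', hv', hv0', hvF'⟩ := hF.exists_reflection_primitive h2 j
  -- If `v' - v = a + b` with `a` fixed by `s_i` and `b` by `s_j`, then `v + a = v' - b` is a
  -- primitive for both reflections.
  let p : (A.WeightLattice → 𝓡) → Prop := fun u => ∃ a ∈ A.coefficientSpace q,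
    ∃ b ∈ A.coefficientSpace q, (∀ x, a ((A.reflection i).1 x) = a x) ∧
      (∀ x, b ((A.reflection j).1 x) = b x) ∧ u = a + b
  have hp0 : p 0 := ⟨0, zero_mem _, 0, zero_mem _, fun _ => rfl, fun _ => rfl, (add_zero 0).symm⟩
  have hpadd : ∀ u v, p u → p v → p (u + v) := by
    rintro _ _ ⟨a, ha, b, hb, ha', hb', rfl⟩ ⟨a₁, ha₁, b₁, hb₁, ha₁', hb₁', rfl⟩
    exact ⟨a + a₁, add_mem ha ha₁, b + b₁, add_mem hb hb₁, fun x => by simp [ha', ha₁'],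
      fun x => by simp [hb', hb₁'], by abel⟩
  have hpsmul : ∀ (r : 𝓡) u, p u → p (r • u) := by
    rintro r _ ⟨a, ha, b, hb, ha', hb', rfl⟩
    exact ⟨r • a, Submodule.smul_mem _ _ ha, r • b, Submodule.smul_mem _ _ hb,
      fun x => by simp [ha'], fun x => by simp [hb'], smul_add _ _ _⟩
  have hpinv : ∀ k, ∀ u ∈ A.coefficientSpace q, (∀ x, u ((A.reflection k).1 x) = u x) → p u := by
    intro k u hu h
    rcases hall k with rfl | rfl
    · exact ⟨u, hu, 0, zero_mem _, h, fun _ => rfl, (add_zero u).symm⟩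
    · exact ⟨0, zero_mem _, u, hu, fun _ => rfl, h, (zero_add u).symm⟩
  have hmono : ∀ k y x, A.monomial q ((A.reflection k).1 y) x =
      A.monomial q y ((A.reflection k).1 x) := fun k y x => by
    rw [monomial_weylGroup, reflection_inv]
  have hinvol : ∀ k x, (A.reflection k).1 ((A.reflection k).1 x) = x := fun k x => by
    rw [← weylGroup_mul_apply, reflection_mul_self, weylGroup_one_apply]
  have hE : ∀ x, A.c x ≠ 0 ∧ |A.c x| < A.dualCoxeterNumber → p (A.monomial q x) := by
    rintro x ⟨hx, hx'⟩
    refine wall_induction hij hall (E := fun x => p (A.monomial q x)) (fun k x h => ?_)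
      (fun k x h => ?_) x hx hx'
    · refine hpinv k _ (monomial_mem x) fun y => ?_
      rw [← hmono, reflection_apply, h, zero_smul, sub_zero]
    -- The sum of a monomial and its mirror image is invariant, so decomposability passes from one
    -- to the other.
    · have h1 : p (A.monomial q x + A.monomial q ((A.reflection k).1 x)) := by
        refine hpinv k _ (add_mem (monomial_mem _) (monomial_mem _)) fun y => ?_
        rw [Pi.add_apply, Pi.add_apply, hmono, hmono, hinvol, add_comm]
      have h3 := hpadd _ _ h1 (hpsmul (-1) _ h)
      simpa using h3
  obtain ⟨a, ha, b, hb, ha', hb', hab⟩ : p (v' - v) :=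
    coefficientSpace_induction hp0 hpadd (fun r y hy => hpsmul r _ (hE y hy)) (sub_mem hv' hv)
      fun x hx => by
        by_cases h : v x = 0
        · exact hF0 _ x (hv0' x fun h' => hx (by simp [h, h']))
        · exact hF0 _ x (hv0 x h)
  have hu : v + a ∈ A.coefficientSpace q := add_mem hv ha
  refine ⟨v + a, hu, fun w x => sub_eq_zero.1
    ((hF.sub_coboundary hu).eq_zero_of_reflection (fun k x => ?_) w x)⟩
  rw [reflection_inv]
  rcases hall k with rfl | rfl
  · simp only [Pi.add_apply, hvF, ha']
    ring
  · have e : ∀ x, v x + a x = v' x - b x := fun x => by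
      have := congrFun hab x
      simp only [Pi.sub_apply, Pi.add_apply] at this
      linear_combination -this
    simp only [Pi.add_apply, hvF', e, hb']
    ring

theorem exists_primitive (hF : A.IsCocycle q F) (h2 : ∀ r : 𝓡, r + r = 0 → r = 0)
    (hq : ∀ n : ℤ, n ≠ 0 → IsUnit (((q ^ n : 𝓡ˣ) : 𝓡) - 1))
    (h : 2 < Fintype.card I ∨ ∀ w x, F w x ≠ 0 → |A.c x| < A.dualCoxeterNumber) :
    ∃ u ∈ A.coefficientSpace q, ∀ w x, F w x = u (w⁻¹.1 x) - u x := by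
  classical
  obtain ⟨u, hu, hu0, huF⟩ := hF.exists_primitive_level_zero h2 hq
  have hG := hF.restrict (S := fun x => A.c x ≠ 0) (fun x => by rw [c_add_delta])
    fun w x => by rw [c_weylGroup]
  obtain ⟨v, hv, hvF⟩ : ∃ v ∈ A.coefficientSpace q,
      ∀ w x, (if A.c x ≠ 0 then F w x else 0) = v (w⁻¹.1 x) - v x := by
    by_cases hI : 2 < Fintype.card I
    · exact hG.exists_primitive_of_two_lt_card hI fun w x hx => by simp [hx]
    · obtain ⟨i⟩ := A.nonempty
      -- A one-by-one matrix with entry `2` cannot kill a positive vector.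
      have hj : ∃ j, i ≠ j := by
        by_contra! hsub
        have h1 : ∑ j, A.a i j * A.marks j = 0 := congrFun A.mulVec_marks i
        rw [Finset.sum_eq_single i (fun j _ hj => (hj (hsub j).symm).elim)
          (fun h => (h (Finset.mem_univ i)).elim), A.diag] at h1
        linarith [A.marks_pos i]
      obtain ⟨j, hij⟩ := hj
      refine hG.exists_primitive_of_card_eq_two h2 hij (fun k => ?_) fun w x hx => ?_
      · by_contra! hk
        exact hI (Fintype.two_lt_card_iff.2 ⟨i, j, k, hij, hk.1.symm, hk.2.symm⟩)
      · by_cases hc : A.c x = 0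
        · simp [hc] at hx
        · rw [if_pos hc] at hx
          exact ⟨hc, h.resolve_left hI w x hx⟩
  let v' : A.WeightLattice → 𝓡 := fun x => if A.c x ≠ 0 then v x else 0
  refine ⟨u + v', add_mem hu (restrict_mem_coefficientSpace (S := fun x => A.c x ≠ 0) hv
    fun x => by rw [c_add_delta]),
    fun w x => ?_⟩
  simp only [Pi.add_apply, v', c_weylGroup]
  have hvx := hvF w x
  by_cases hx : A.c x = 0
  · simp only [hx, ne_eq, not_true_eq_false, if_false, add_zero]
    exact huF w x hx
  · rw [if_pos hx] at hvx
    rw [if_pos hx, if_pos hx, hu0 x hx, hu0 _ (by rwa [c_weylGroup]), hvx, zero_add, zero_add]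

end IsCocycle

end

/-! ### Arithmetic of `R` -/

theorem R_eq_zero_of_add_self (r : R) (h : r + r = 0) : r = 0 := by
  have h' : (r : RatFunc ℚ) + r = 0 := congrArg Subtype.val h
  exact Subtype.ext (add_self_eq_zero.1 h')

theorem X_pow_sub_one_ne_zero {n : ℕ} (hn : 0 < n) : (RatFunc.X ^ n - 1 : RatFunc ℚ) ≠ 0 := by
  have h : (RatFunc.X ^ n - 1 : RatFunc ℚ) =
      algebraMap (Polynomial ℚ) (RatFunc ℚ) (Polynomial.X ^ n - Polynomial.C 1) := by
    simp [RatFunc.algebraMap_X]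
  rw [h]
  exact RatFunc.algebraMap_ne_zero (Polynomial.X_pow_sub_C_ne_zero hn 1)

theorem isUnit_expDelta_pow_sub_one {n : ℕ} (hn : 0 < n) :
    IsUnit (((expDelta ^ n : Rˣ) : R) - 1) := by
  refine IsUnit.of_mul_eq_one ⟨(RatFunc.X ^ n - 1)⁻¹, Subring.subset_closure (Or.inr ⟨n, hn, rfl⟩)⟩
    (Subtype.ext ?_)
  rw [Units.val_pow_eq_pow_val]
  exact mul_inv_cancel₀ (X_pow_sub_one_ne_zero hn)

theorem isUnit_expDelta_zpow_sub_one {n : ℤ} (hn : n ≠ 0) :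
    IsUnit (((expDelta ^ n : Rˣ) : R) - 1) := by
  rcases lt_or_gt_of_ne hn with h | h
  · obtain ⟨m, rfl⟩ := Int.exists_eq_neg_ofNat h.le
    have e : ((expDelta ^ (-(m : ℤ)) : Rˣ) : R) - 1 =
        -((expDelta ^ (-(m : ℤ)) : Rˣ) : R) * (((expDelta ^ m : Rˣ) : R) - 1) := by
      rw [mul_sub, neg_mul, ← Units.val_mul, zpow_neg, zpow_natCast, inv_mul_cancel,
        Units.val_one]
      ring
    rw [e]
    exact (Units.isUnit _).neg.mul (isUnit_expDelta_pow_sub_one (by omega))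
  · obtain ⟨m, rfl⟩ := Int.eq_ofNat_of_zero_le h.le
    rw [zpow_natCast]
    exact isUnit_expDelta_pow_sub_one (by omega)

theorem algebraMap_C_mul_T (a n : ℤ) :
    algebraMap ℤ[T;T⁻¹] R (LaurentPolynomial.C a * LaurentPolynomial.T n) =
      (a : R) * ((expDelta ^ n : Rˣ) : R) :=
  LaurentPolynomial.eval₂_C_mul_T _ _ _ _

/-! ### Identification of `R ⊗ M` with coefficient functions -/

section

variable {I : Type} [Fintype I] (A : AffineCartanMatrix I)

/-- The element `a e^x` of the group ring. -/
noncomputable def expSingle (x : A.WeightLattice) (a : ℤ) : A.GroupRing :=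
  AddMonoidAlgebra.single x a

theorem smul_expSingle (a n b : ℤ) (x : A.WeightLattice) :
    (LaurentPolynomial.C a * LaurentPolynomial.T n : ℤ[T;T⁻¹]) • A.expSingle x b =
      A.expSingle (x + n • A.delta) (a * b) := by
  rw [← LaurentPolynomial.single_eq_C_mul_T, smul_groupRing_def]
  have h : A.laurentToGroupRing (AddMonoidAlgebra.single n a) = A.expSingle (n • A.delta) a :=
    AddMonoidAlgebra.mapDomain_single
  rw [h, add_comm]
  exact AddMonoidAlgebra.single_mul_single _ _ _ _

theorem groupRing_induction {p : A.GroupRing → Prop} (f : A.GroupRing) (zero : p 0)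
    (add : ∀ f g, p f → p g → p (f + g)) (single : ∀ x a, p (A.expSingle x a)) : p f :=
  AddMonoidAlgebra.induction_linear (motive := p) f zero add single

/-- The additive map from the group ring to coefficient functions. -/
noncomputable def coefficientAddHom : A.GroupRing →+ (A.WeightLattice → R) :=
  (Finsupp.liftAddHom fun y => zmultiplesHom (A.WeightLattice → R)
    (A.monomial expDelta y)).comp
    (AddMonoidAlgebra.coeffAddEquiv (R := ℤ) (M := A.WeightLattice)).toAddMonoidHom

theorem coefficientAddHom_expSingle (y : A.WeightLattice) (a : ℤ) :
    A.coefficientAddHom (A.expSingle y a) = a • A.monomial expDelta y :=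
  Finsupp.liftAddHom_apply_single _ _ _

/-- The map from the group ring to coefficient functions. -/
noncomputable def coefficientMap : A.GroupRing →ₗ[ℤ[T;T⁻¹]] (A.WeightLattice → R) where
  toFun := A.coefficientAddHom
  map_add' := map_add _
  map_smul' p f := by
    change A.coefficientAddHom (p • f) = p • A.coefficientAddHom f
    induction p using LaurentPolynomial.induction_on' with
    | add p q hp hq => rw [add_smul, map_add, hp, hq, add_smul]
    | C_mul_T n a =>
      induction f using groupRing_induction with
      | zero => simp only [smul_zero, map_zero]
      | add f g hf hg => rw [smul_add, map_add, hf, hg, map_add, smul_add]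
      | single x b =>
        rw [smul_expSingle, coefficientAddHom_expSingle, coefficientAddHom_expSingle]
        funext y
        rw [Pi.smul_apply, Pi.smul_apply, Pi.smul_apply, monomial_add_zsmul_left,
          Algebra.smul_def (R := ℤ[T;T⁻¹]), algebraMap_C_mul_T, zsmul_eq_mul, zsmul_eq_mul]
        push_cast
        ring

theorem coefficientMap_expSingle (y : A.WeightLattice) (a : ℤ) :
    A.coefficientMap (A.expSingle y a) = a • A.monomial expDelta y :=
  A.coefficientAddHom_expSingle y a

variable {A} {M : Type} [AddCommGroup M] [Module ℤ[T;T⁻¹] M]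

/-- The map from `R ⊗ M` to coefficient functions, for a module `M` over the group ring. -/
noncomputable def tensorCoefficientMap (j : M →ₗ[ℤ[T;T⁻¹]] A.GroupRing) :
    R ⊗[ℤ[T;T⁻¹]] M →ₗ[ℤ[T;T⁻¹]] (A.WeightLattice → R) :=
  TensorProduct.lift (LinearMap.mk₂ _ (fun r m => r • A.coefficientMap (j m))
    (fun r s m => add_smul _ _ _) (fun p r m => smul_assoc _ _ _)
    (fun r m m' => by rw [map_add, map_add, smul_add])
    (fun p r m => by rw [map_smul, map_smul, smul_comm]))

theorem tensorCoefficientMap_tmul (j : M →ₗ[ℤ[T;T⁻¹]] A.GroupRing) (r : R) (m : M) :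
    tensorCoefficientMap j (r ⊗ₜ m) = r • A.coefficientMap (j m) := rfl

variable (A) in
/-- A `ℤ[e^{±δ}]`-module `M` identified by `j` with the span of the `e^x` for `x ∈ D`; for such
`x` the element `e x` of `M` corresponds to `e^x`. -/
structure SpannedBy (D : Set A.WeightLattice) (j : M →ₗ[ℤ[T;T⁻¹]] A.GroupRing)
    (e : A.WeightLattice → M) : Prop where
  add_delta : ∀ x, x + A.delta ∈ D ↔ x ∈ D
  injective : Function.Injective j
  apply_mem : ∀ x ∈ D, j (e x) = A.expSingle x 1
  eq_zero : ∀ x ∉ D, e x = 0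
  supported : ∀ m, j m ∈ Submodule.span ℤ ((fun x => A.expSingle x 1) '' D)

namespace SpannedBy

variable {D : Set A.WeightLattice} {j : M →ₗ[ℤ[T;T⁻¹]] A.GroupRing} {e : A.WeightLattice → M}

theorem add_zsmul (h : A.SpannedBy D j e) (x : A.WeightLattice) (n : ℤ) :
    x + n • A.delta ∈ D ↔ x ∈ D := by
  induction n using Int.induction_on with
  | zero => simp
  | succ n ih => rw [← ih, ← h.add_delta (x + (n : ℤ) • A.delta)]; congr! 1; module
  | pred n ih => rw [← ih, ← h.add_delta (x + (-(n : ℤ) - 1) • A.delta)]; congr! 1; module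

theorem closure_eq_top (h : A.SpannedBy D j e) : AddSubgroup.closure (Set.range e) = ⊤ := by
  refine (AddSubgroup.eq_top_iff' _).2 fun m => ?_
  let K := (AddSubgroup.closure (Set.range e)).map j.toAddMonoidHom
  have hle : Submodule.span ℤ ((fun x => A.expSingle x 1) '' D) ≤ AddSubgroup.toIntSubmodule K := by
    rw [Submodule.span_le]
    rintro _ ⟨x, hx, rfl⟩
    exact ⟨e x, AddSubgroup.subset_closure ⟨x, rfl⟩, h.apply_mem x hx⟩
  obtain ⟨k, hk, hkm⟩ := hle (h.supported m)
  exact h.injective hkm ▸ hk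

theorem tensor_induction (h : A.SpannedBy D j e) {p : R ⊗[ℤ[T;T⁻¹]] M → Prop}
    (v : R ⊗[ℤ[T;T⁻¹]] M) (zero : p 0) (add : ∀ v w, p v → p w → p (v + w))
    (tmul : ∀ (r : R) x, p (r ⊗ₜ e x)) : p v := by
  induction v with
  | zero => exact zero
  | add v w hv hw => exact add v w hv hw
  | tmul r m =>
    have hm : m ∈ AddSubgroup.closure (Set.range e) := h.closure_eq_top ▸ AddSubgroup.mem_top m
    induction hm using AddSubgroup.closure_induction generalizing r with
    | mem m hm => obtain ⟨x, rfl⟩ := hm; exact tmul r x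
    | zero => rw [TensorProduct.tmul_zero]; exact zero
    | add m m' _ _ hm hm' => rw [TensorProduct.tmul_add]; exact add _ _ (hm r) (hm' r)
    | neg m _ hm => rw [TensorProduct.tmul_neg, ← TensorProduct.neg_tmul]; exact hm (-r)

theorem map_tmul_of_mem (h : A.SpannedBy D j e) (r : R) {x : A.WeightLattice} (hx : x ∈ D) :
    tensorCoefficientMap j (r ⊗ₜ e x) = r • A.monomial expDelta x := by
  rw [tensorCoefficientMap_tmul, h.apply_mem x hx, coefficientMap_expSingle, one_smul]

theorem map_mem (h : A.SpannedBy D j e) (v : R ⊗[ℤ[T;T⁻¹]] M) :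
    tensorCoefficientMap j v ∈ A.coefficientSpace expDelta ∧
      ∀ x, tensorCoefficientMap j v x ≠ 0 → x ∈ D := by
  induction v using h.tensor_induction with
  | zero => rw [map_zero]; exact ⟨zero_mem _, fun x hx => (hx rfl).elim⟩
  | add v w hv hw =>
    rw [map_add]
    refine ⟨add_mem hv.1 hw.1, fun x hx => ?_⟩
    by_cases h0 : tensorCoefficientMap j v x = 0
    · exact hw.2 x fun h' => hx (by rw [Pi.add_apply, h0, h', add_zero])
    · exact hv.2 x h0
  | tmul r y =>
    by_cases hy : y ∈ D
    · rw [h.map_tmul_of_mem r hy]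
      refine ⟨Submodule.smul_mem _ _ (monomial_mem y), fun x hx => ?_⟩
      by_contra hxD
      refine hx ?_
      rw [Pi.smul_apply, monomial_eq_zero, smul_zero]
      rintro ⟨n, rfl⟩
      exact hxD ((h.add_zsmul x n).1 hy)
    · rw [h.eq_zero y hy, TensorProduct.tmul_zero, map_zero]
      exact ⟨zero_mem _, fun x hx => (hx rfl).elim⟩

theorem exists_map_eq (h : A.SpannedBy D j e) {u : A.WeightLattice → R}
    (hu : u ∈ A.coefficientSpace expDelta) (hD : ∀ x, u x ≠ 0 → x ∈ D) :
    ∃ v, tensorCoefficientMap j v = u :=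
  coefficientSpace_induction (p := fun u => ∃ v, tensorCoefficientMap j v = u) (D := (· ∈ D))
    ⟨0, map_zero _⟩ (by rintro _ _ ⟨v, rfl⟩ ⟨w, rfl⟩; exact ⟨v + w, map_add _ _ _⟩)
    (fun r y hy => ⟨r ⊗ₜ e y, h.map_tmul_of_mem r hy⟩) hu hD

theorem tmul_add_zsmul (h : A.SpannedBy D j e) (r : R) (x : A.WeightLattice) (n : ℤ) :
    r ⊗ₜ[ℤ[T;T⁻¹]] e (x + n • A.delta) = (((expDelta ^ n : Rˣ) : R) * r) ⊗ₜ e x := by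
  have he : e (x + n • A.delta) =
      (LaurentPolynomial.C 1 * LaurentPolynomial.T n : ℤ[T;T⁻¹]) • e x := by
    by_cases hx : x ∈ D
    · apply h.injective
      rw [map_smul, h.apply_mem x hx, h.apply_mem _ ((h.add_zsmul x n).2 hx), smul_expSingle,
        mul_one]
    · rw [h.eq_zero x hx, h.eq_zero _ fun h' => hx ((h.add_zsmul x n).1 h'), smul_zero]
  rw [he, ← TensorProduct.smul_tmul, Algebra.smul_def, algebraMap_C_mul_T, Int.cast_one, one_mul]

/-- After choosing a representative of each coset of `ℤδ`, every tensor is a finite sum of `r_c ⊗ e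
c.out`. When `c.out ∈ D`, evaluating its image there returns `r_c`; the other terms vanish. -/
theorem map_injective (h : A.SpannedBy D j e) : Function.Injective (tensorCoefficientMap j) := by
  refine (injective_iff_map_eq_zero _).2 fun v hv => ?_
  let C := A.WeightLattice ⧸ AddSubgroup.zmultiples A.delta
  have hout : ∀ (x : A.WeightLattice), ∃ n : ℤ, x = (x : C).out + n • A.delta := by
    intro x
    have h1 : ((x : C).out : C) = (x : C) := QuotientAddGroup.out_eq' _
    obtain ⟨n, hn⟩ := AddSubgroup.mem_zmultiples_iff.1 (QuotientAddGroup.eq.1 h1)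
    exact ⟨n, by rw [hn]; abel⟩
  let τ : C → R → R ⊗[ℤ[T;T⁻¹]] M := fun c r => r ⊗ₜ e c.out
  have τ_zero : ∀ c, τ c 0 = 0 := fun c => TensorProduct.zero_tmul _ _
  have τ_add : ∀ c r s, τ c (r + s) = τ c r + τ c s := fun c r s => TensorProduct.add_tmul _ _ _
  have hrep : ∃ f : C →₀ R, v = f.sum τ := by
    clear hv
    induction v using h.tensor_induction with
    | zero => exact ⟨0, Finsupp.sum_zero_index.symm⟩
    | add v w hv hw =>
      obtain ⟨f, rfl⟩ := hv
      obtain ⟨g, rfl⟩ := hw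
      exact ⟨f + g, (Finsupp.sum_add_index' τ_zero τ_add).symm⟩
    | tmul r x =>
      obtain ⟨n, hn⟩ := hout x
      refine ⟨Finsupp.single (x : C) (((expDelta ^ n : Rˣ) : R) * r), ?_⟩
      rw [Finsupp.sum_single_index (τ_zero _)]
      exact (congrArg (fun z => r ⊗ₜ e z) hn).trans (h.tmul_add_zsmul r _ n)
  obtain ⟨f, rfl⟩ := hrep
  refine Finset.sum_eq_zero fun c hc => ?_
  change f c ⊗ₜ e c.out = 0
  by_cases hcD : c.out ∈ D
  · have hfc := congrFun hv c.out
    rw [Finsupp.sum, map_sum, Finset.sum_apply, Finset.sum_eq_single c, h.map_tmul_of_mem _ hcD,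
      Pi.smul_apply, monomial_eq (n := 0) (by simp), zpow_zero, Units.val_one, smul_eq_mul,
      mul_one] at hfc
    · rw [hfc]
      exact TensorProduct.zero_tmul _ _
    · intro c' _ hne
      change tensorCoefficientMap j (f c' ⊗ₜ e c'.out) c.out = 0
      by_cases hc' : c'.out ∈ D
      · rw [h.map_tmul_of_mem _ hc', Pi.smul_apply, monomial_eq_zero, smul_zero]
        rintro ⟨n, hn⟩
        refine hne ?_
        rw [← QuotientAddGroup.out_eq' c', ← QuotientAddGroup.out_eq' c]
        refine (QuotientAddGroup.eq.2 (AddSubgroup.mem_zmultiples_iff.2 ⟨n, ?_⟩)).symm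
        rw [hn]
        abel
      · rw [h.eq_zero _ hc', TensorProduct.tmul_zero, map_zero]
        rfl
    · exact fun h' => (h' hc).elim
  · rw [h.eq_zero _ hcD, TensorProduct.tmul_zero]

end SpannedBy

variable (A) in
theorem spannedBy_univ : A.SpannedBy Set.univ (LinearMap.id : A.GroupRing →ₗ[ℤ[T;T⁻¹]] A.GroupRing)
    fun x => A.expSingle x 1 where
  add_delta x := by simp
  injective := Function.injective_id
  apply_mem x _ := rfl
  eq_zero x hx := (hx (Set.mem_univ x)).elim
  supported m := by
    have hm : (m : AddMonoidAlgebra ℤ A.WeightLattice) ∈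
        AddMonoidAlgebra.supported ℤ ℤ (Set.univ : Set A.WeightLattice) := Set.subset_univ _
    rw [AddMonoidAlgebra.supported_eq_span_single] at hm
    exact hm

variable [DecidableEq I]

theorem coefficientMap_groupRingRep (w : A.weylGroup) (f : A.GroupRing) (x : A.WeightLattice) :
    A.coefficientMap (A.groupRingRep w f) x = A.coefficientMap f (w⁻¹.1 x) := by
  induction f using groupRing_induction with
  | zero => simp only [map_zero, Pi.zero_apply]
  | add f g hf hg => rw [map_add, map_add, Pi.add_apply, hf, hg, map_add, Pi.add_apply]
  | single y a =>
    have h : A.groupRingRep w (A.expSingle y a) = A.expSingle (w.1 y) a :=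
      AddMonoidAlgebra.mapDomain_single
    rw [h, coefficientMap_expSingle, coefficientMap_expSingle, Pi.smul_apply, Pi.smul_apply,
      monomial_weylGroup]

theorem tensorCoefficientMap_lTensor {σ : Representation ℤ[T;T⁻¹] A.weylGroup M}
    {j : M →ₗ[ℤ[T;T⁻¹]] A.GroupRing} (hj : ∀ w m, j (σ w m) = A.groupRingRep w (j m))
    (w : A.weylGroup) (v : R ⊗[ℤ[T;T⁻¹]] M) (x : A.WeightLattice) :
    tensorCoefficientMap j (LinearMap.lTensor R (σ w) v) x =
      tensorCoefficientMap j v (w⁻¹.1 x) := by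
  induction v with
  | zero => simp only [map_zero, Pi.zero_apply]
  | add v v' hv hv' => rw [map_add, map_add, Pi.add_apply, hv, hv', map_add, Pi.add_apply]
  | tmul r m =>
    rw [LinearMap.lTensor_tmul, tensorCoefficientMap_tmul, tensorCoefficientMap_tmul, hj,
      Pi.smul_apply, Pi.smul_apply, coefficientMap_groupRingRep]

/-- Both parts of the theorem are instances: `D` is the whole lattice or the set of weights of small
level. -/
theorem SpannedBy.subsingleton_H1 {D : Set A.WeightLattice} {j : M →ₗ[ℤ[T;T⁻¹]] A.GroupRing}
    {e : A.WeightLattice → M} (h : A.SpannedBy D j e)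
    {σ : Representation ℤ[T;T⁻¹] A.weylGroup M}
    (hj : ∀ w m, j (σ w m) = A.groupRingRep w (j m))
    (hD : ∀ (w : A.weylGroup) x, w.1 x ∈ D ↔ x ∈ D)
    (hsmall : 2 < Fintype.card I ∨ ∀ x ∈ D, |A.c x| < A.dualCoxeterNumber) :
    Subsingleton (groupCohomology (tensorR σ) 1) := by
  classical
  refine subsingleton_of_forall_eq 0 fun ξ => ?_
  refine groupCohomology.H1_induction_on (A := tensorR σ) (C := fun ξ => ξ = 0) ξ fun f => ?_
  rw [groupCohomology.H1π_eq_zero_iff]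
  let Φ := tensorCoefficientMap j
  let F : A.weylGroup → A.WeightLattice → R := fun w => Φ (f w)
  have hF : A.IsCocycle expDelta F :=
    { mem := fun w => (h.map_mem (f w)).1
      mul := fun v w x => by
        have hf := (groupCohomology.mem_cocycles₁_iff (f : A.weylGroup → tensorR σ)).1 f.2 v w
        change Φ (f (v * w)) x = Φ (f w) (v⁻¹.1 x) + Φ (f v) x
        rw [hf, ← tensorCoefficientMap_lTensor hj v (f w) x]
        exact congrFun (map_add Φ (LinearMap.lTensor R (σ v) (f w)) (f v)) x }
  obtain ⟨u, hu, huF⟩ := hF.exists_primitive R_eq_zero_of_add_self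
    (fun n hn => isUnit_expDelta_zpow_sub_one hn)
    (hsmall.imp_right fun hs w x hx => hs x ((h.map_mem (f w)).2 x hx))
  -- The primitive may have support outside `D`. Cutting it off is harmless, since `D` is stable
  -- under the Weyl group and the cocycle is supported in `D`.
  let u' : A.WeightLattice → R := fun x => if x ∈ D then u x else 0
  obtain ⟨v, hv⟩ := h.exists_map_eq (u := u')
    (restrict_mem_coefficientSpace (S := (· ∈ D)) hu h.add_delta)
    fun x hx => by
      by_contra hxD
      exact hx (if_neg hxD)
  refine ⟨v, funext fun w => h.map_injective (funext fun x => ?_)⟩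
  have e1 : Φ (LinearMap.lTensor R (σ w) v - v) x = u' (w⁻¹.1 x) - u' x := by
    rw [map_sub, Pi.sub_apply, tensorCoefficientMap_lTensor hj, hv]
  refine e1.trans ?_
  change u' (w⁻¹.1 x) - u' x = F w x
  by_cases hx : x ∈ D
  · simp only [u', hD, if_pos hx]
    exact (huF w x).symm
  · simp only [u', hD, if_neg hx, sub_zero]
    by_contra h0
    exact hx ((h.map_mem (f w)).2 x fun h' => h0 h'.symm)

variable (A)

theorem expSingle_mem_lowLevel {x : A.WeightLattice} (hx : |A.c x| < A.dualCoxeterNumber) :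
    A.expSingle x 1 ∈ A.lowLevel.toSubmodule := by
  have h : (AddMonoidAlgebra.single x 1 : AddMonoidAlgebra ℤ A.WeightLattice) ∈
      AddMonoidAlgebra.supported ℤ ℤ {x : A.WeightLattice | |A.c x| < A.dualCoxeterNumber} := by
    rw [AddMonoidAlgebra.supported_eq_span_single]
    exact Submodule.subset_span ⟨x, hx, rfl⟩
  exact h

open Classical in
theorem spannedBy_lowLevel :
    A.SpannedBy {x : A.WeightLattice | |A.c x| < A.dualCoxeterNumber} A.lowLevel.toSubmodule.subtype
      fun x => if hx : |A.c x| < A.dualCoxeterNumber then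
        ⟨A.expSingle x 1, A.expSingle_mem_lowLevel hx⟩ else 0 where
  add_delta x := by simp only [Set.mem_ofPred_eq, c_add_delta]
  injective := Subtype.val_injective
  apply_mem x hx := by
    rw [dif_pos (show |A.c x| < A.dualCoxeterNumber from hx)]
    rfl
  eq_zero x hx := dif_neg hx
  supported m := by
    have hm : (m.1 : AddMonoidAlgebra ℤ A.WeightLattice) ∈
        AddMonoidAlgebra.supported ℤ ℤ
          {x : A.WeightLattice | |A.c x| < A.dualCoxeterNumber} := m.2
    rw [AddMonoidAlgebra.supported_eq_span_single] at hm
    exact hm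

end

end AffineCartanMatrix

theorem theorem5p2 {I : Type} [Fintype I] [DecidableEq I] (A : AffineCartanMatrix I) :
    (2 < Fintype.card I →
      Subsingleton (groupCohomology (AffineCartanMatrix.tensorR A.groupRingRep) 1)) ∧
    Subsingleton
      (groupCohomology (AffineCartanMatrix.tensorR A.lowLevel.toRepresentation) 1) := by
  refine ⟨fun hI => A.spannedBy_univ.subsingleton_H1 (fun _ _ => rfl)
    (fun _ _ => by simp) (Or.inl hI), A.spannedBy_lowLevel.subsingleton_H1 (fun _ _ => rfl)
    (fun w x => ?_) (Or.inr fun _ hx => hx)⟩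
  simp only [Set.mem_ofPred_eq, AffineCartanMatrix.c_weylGroup]
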